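/- \textbf{Setting.} For each sample size $n$ let $p=p_n$, let $A=(a_{jk})$ be a $p\times p$ real matrix all of whose complex eigenvalues have modulus $<1$, and let $(\mathbf y_t)_{t\ge 0}$ be the stationary Gaussian VAR(1) process $\mathbf y_t=A\mathbf y_{t-1}+\mathbf e_t$, $t\ge 1$, where $\mathbf e_1,\mathbf e_2,\dots$ are i.i.d. $\mathcal N_p(0,\Sigma_{\mathbf e})$ and independent of $\mathbf y_0$ (all these objects may depend on $n$). Assume that the dependence structure is uniformly controlled: for constants $m>0$ and $M$ not depending on $n$, the eigenvalues of $\Sigma_{\mathbf e}$ lie in $[m,M]$ and $\Lambda_{\min}\big((I-zA)^*(I-zA)\big)\ge m$ for all $z\in\mathbb C$ with $|z|=1$. Fix for each $n$ a row index $i=i_n$, let $a_i$ be the $i$th row of $A$ and $s_i=|\{j:a_{ij}\ne0\}|$, and assume, as $n\to\infty$, $$p\to\infty,\qquad \frac{\log p}{n}\to0,\qquad \frac{s_i\log p}{\sqrt n}\to0$$ (the second condition follows from the third when $s_i\ge1$). Put $\mathbf X=(\mathbf y_0,\dots,\mathbf y_{n-1})^{\mathsf T}$, $Y_i=(y_{i1},\dots,y_{in})^{\mathsf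 T}$, $\varepsilon_i=(e_{i1},\dots,e_{in})^{\mathsf T}$, and for $\lambda\ge 0$ let $$\hat a_i^{\rm Lasso}\in\operatorname*{argmin}_{\alpha\in\mathbb R^p}\big\{\|Y_i-\mathbf X\alpha\|_2^2/n+2\lambda\|\alpha\|_1\big\},\qquad \hat s_i=|\{j:\hat a^{\rm Lasso}_{ij}\neq0\}|.$$ \textbf{Constants.} For constants $C_1>0$ and $0<c_*<c^*$ consider the properties (D) with probability tending to one, $\|\mathbf X^{\mathsf T}\varepsilon_i/n\|_\infty\le C_1\sqrt{\log p/n}$; (R) (sparse Riesz condition) for every integer sequence $s_R>(2+2c^*/c_*)s_i+1$ with $s_R=O(\max\{1,s_i\})$, with probability tending to one, $c_*\|v\|_2^2\le\|\mathbf Xv\|_2^2/n\le c^*\|v\|_2^2$ for all $v\in\mathbb R^p$ with at most $s_R$ nonzero entries. \textbf{Theorem.} (i) There are constants $C_1>0$ and $0<c_*<c^*$, depending only on $m$ and $M$, such that (D) and (R) hold for every sequence of models as above. (ii) For every sequence of models as above and any constants $C_1>0$, $0<c_*<c^*$ with properties (D) and (R), the following holds: for any deterministic sequence $$\lambda=\lambda_n\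 \ge\ \frac{4C_1c^*}{c_*}\sqrt{\frac{\log p}{n}}$$ and any choice of the Lasso minimiser, $$\hat s_i=O_p(s_i),$$ that is, for every $\epsilon>0$ there is $K$ such that $P(\hat s_i>K s_i)\le\epsilon$ for all sufficiently large $n$. -/

import Mathlib

open MeasureTheory ProbabilityTheory Filter Topology

universe u

noncomputable section

/-- A stable, stationary Gaussian VAR(1) model of dimension `p`, observed at times `0, 1, 2, …`:
`y (t + 1) = A y t + e (t + 1)` with i.i.d. innovations `e 1, e 2, … ∼ N(0, Sig)` that are
independent of `y 0`; every eigenvalue of `A` has modulus less than one. -/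
structure GaussianVAR where
  p : ℕ
  A : Matrix (Fin p) (Fin p) ℝ
  Sig : Matrix (Fin p) (Fin p) ℝ
  Ω : Type u
  mΩ : MeasurableSpace Ω
  μ : Measure Ω
  y : ℕ → Ω → EuclideanSpace ℝ (Fin p)
  e : ℕ → Ω → EuclideanSpace ℝ (Fin p)
  isProb : IsProbabilityMeasure μ
  sig_posSemidef : Sig.PosSemidef
  stable : ∀ z ∈ spectrum ℂ (A.map (fun x : ℝ => (x : ℂ))), ‖z‖ < 1
  measurable_y : ∀ t, Measurable (y t)
  measurable_e : ∀ t, Measurable (e t)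
  law_e : ∀ t, μ.map (e (t + 1)) = multivariateGaussian 0 Sig
  indep_e : iIndepFun (fun t => e (t + 1)) μ
  indep_init : IndepFun (y 0) (fun ω t => e (t + 1) ω) μ
  recursion : ∀ t, ∀ᵐ ω ∂μ, ∀ j, y (t + 1) ω j = (A.mulVec (y t ω)) j + e (t + 1) ω j
  stationary : ∀ t, μ.map (y t) = μ.map (y 0)

attribute [instance] GaussianVAR.mΩ GaussianVAR.isProb

namespace GaussianVAR

/-- The design matrix of the sample of size `n`: its rows are `y 0, …, y (n - 1)`. -/
def design (V : GaussianVAR.{u}) (n : ℕ) (ω : V.Ω) : Matrix (Fin n) (Fin V.p) ℝ :=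
  fun t j => V.y t ω j

/-- The response vector of the `i`-th equation: `y 1, …, y n` in coordinate `i`. -/
def response (V : GaussianVAR.{u}) (i : Fin V.p) (n : ℕ) (ω : V.Ω) : Fin n → ℝ :=
  fun t => V.y (t + 1) ω i

/-- The noise vector of the `i`-th equation: `e 1, …, e n` in coordinate `i`. -/
def noise (V : GaussianVAR.{u}) (i : Fin V.p) (n : ℕ) (ω : V.Ω) : Fin n → ℝ :=
  fun t => V.e (t + 1) ω i

/-- Bounds on the dependence structure: the eigenvalues of the innovation covariance lie in
`[m, M]`, and `Λ_min((I - zA)ᴴ (I - zA)) ≥ m` for every `z` on the complex unit circle. -/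
structure DependenceBounds (V : GaussianVAR.{u}) (m M : ℝ) : Prop where
  sig_lower : ∀ x : Fin V.p → ℝ, m * ∑ j, x j ^ 2 ≤ x ⬝ᵥ V.Sig.mulVec x
  sig_upper : ∀ x : Fin V.p → ℝ, x ⬝ᵥ V.Sig.mulVec x ≤ M * ∑ j, x j ^ 2
  transfer_lower : ∀ z : ℂ, ‖z‖ = 1 → ∀ v : Fin V.p → ℂ,
    m * ∑ j, ‖v j‖ ^ 2 ≤
      ∑ j, ‖((1 - z • V.A.map (fun x : ℝ => (x : ℂ))).mulVec v) j‖ ^ 2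

end GaussianVAR

/-- The number of nonzero entries of a vector. -/
def numNonzero {p : ℕ} (v : Fin p → ℝ) : ℕ := {j | v j ≠ 0}.ncard

/-- `α` minimises the Lasso criterion `‖Y - X α‖₂² / n + 2 lam ‖α‖₁`. -/
def IsLasso {n p : ℕ} (X : Matrix (Fin n) (Fin p) ℝ) (Y : Fin n → ℝ) (lam : ℝ)
    (α : Fin p → ℝ) : Prop :=
  IsMinOn (fun β : Fin p → ℝ => (∑ t, (Y t - X.mulVec β t) ^ 2) / (n : ℝ) + 2 * lam * ∑ j, |β j|)
    Set.univ α

/-- The number of nonzero entries of the `i`-th row of the transition matrix. -/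
def rowSparsity (V : ℕ → GaussianVAR.{u}) (i : ∀ n, Fin (V n).p) (n : ℕ) : ℕ :=
  numNonzero ((V n).A (i n))

/-- The events `E n` hold with probability tending to one. -/
def HoldsWHP (V : ℕ → GaussianVAR.{u}) (E : ∀ n, Set (V n).Ω) : Prop :=
  Tendsto (fun n => (V n).μ (E n)ᶜ) atTop (𝓝 0)

/-- `Z n = O_p(b n)`, written without division so that `b n = 0` is meaningful. -/
def IsBigOInProb (V : ℕ → GaussianVAR.{u}) (Z : ∀ n, (V n).Ω → ℝ) (b : ℕ → ℝ) : Prop :=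
  ∀ ε : ℝ, 0 < ε → ∃ K : ℝ, ∀ᶠ n in atTop, (V n).μ {ω | K * |b n| < |Z n ω|} ≤ ENNReal.ofReal ε

/-- The asymptotic regime: for each sample size `n` a model `V n` and a row `i n` of it, such that
the dependence structure is controlled uniformly in `n`, the dimension diverges with
`log p / n → 0`, and the row is sparse: `s log p / √n → 0`.  (If `s ≥ 1`, then the last condition
implies the one on `log p / n`.) -/
structure SparseRegime (V : ℕ → GaussianVAR.{u}) (i : ∀ n, Fin (V n).p) (m M : ℝ) : Prop where
  bounds : ∀ n, (V n).DependenceBounds m M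
  dim : Tendsto (fun n => (V n).p) atTop atTop
  log_dim : Tendsto (fun n => Real.log (V n).p / (n : ℝ)) atTop (𝓝 0)
  sparse : Tendsto (fun n => (rowSparsity V i n : ℝ) * Real.log (V n).p / √(n : ℝ)) atTop (𝓝 0)

/-- `C₁` is a deviation constant: with probability tending to one,
`‖Xᵀ ε_i / n‖_∞ ≤ C₁ √(log p / n)`. -/
def IsDeviationConstant (V : ℕ → GaussianVAR.{u}) (i : ∀ n, Fin (V n).p) (C₁ : ℝ) : Prop :=
  HoldsWHP V fun n => {ω | ∀ j,
    |(((V n).design n ω).transpose.mulVec ((V n).noise (i n) n ω)) j / (n : ℝ)|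
      ≤ C₁ * √(Real.log (V n).p / (n : ℝ))}

/-- The sparse Riesz condition with constants `cLo`, `cUp`: for every sequence of sparsity levels
`sR > (2 + 2 cUp / cLo) s + 1` of order `O(max 1 s)`, with probability tending to one,
`cLo ‖v‖₂² ≤ ‖X v‖₂² / n ≤ cUp ‖v‖₂²` for all `v` with at most `sR` nonzero entries. -/
def IsSparseRiesz (V : ℕ → GaussianVAR.{u}) (i : ∀ n, Fin (V n).p) (cLo cUp : ℝ) : Prop :=
  ∀ sR : ℕ → ℕ,
    (∀ n, (2 + 2 * cUp / cLo) * (rowSparsity V i n : ℝ) + 1 < (sR n : ℝ)) →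
    (fun n => (sR n : ℝ)) =O[atTop] (fun n => max 1 (rowSparsity V i n : ℝ)) →
    HoldsWHP V fun n => {ω | ∀ v : Fin (V n).p → ℝ, numNonzero v ≤ sR n →
      cLo * ∑ j, v j ^ 2 ≤ (∑ t, (((V n).design n ω).mulVec v t) ^ 2) / (n : ℝ) ∧
      (∑ t, (((V n).design n ω).mulVec v t) ^ 2) / (n : ℝ) ≤ cUp * ∑ j, v j ^ 2}

end

/-!
The argument works in the time domain and with entrywise bounds only.

*Dependence.* A linear functional `∑ w t ⬝ y t` of the trajectory is rewritten, by summation by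
parts along the recursion, as a functional of the independent variables `y 0, e 1, e 2, …` with
coefficients solving the adjoint recursion `u t = Aᵀ u (t + 1) + w t`. By Parseval's identity the
lower bound on the transfer function says exactly that `m ‖u‖² ≤ ‖w‖²` in `ℓ²`
(`sum_sq_le_of_transfer_lower`, `exists_adjoint_solution`). The law of `y 0` is identified as the
centred Gaussian law with covariance `∑ Aᵏ Σ (Aᵏ)ᵀ` by unrolling the recursion infinitely often in
the characteristic function (`GaussianVAR.DependenceBounds.map_dotProduct_y_zero`). Hence all
functionals of the sample are centred Gaussian with a variance of at most `K ‖w‖²`, where `K`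
depends on `m` and `M` only (`GaussianVAR.DependenceBounds.exists_map_eq_gaussianReal`).

*Concentration.* In an eigenbasis of its covariance a Gaussian vector has independent coordinates,
which gives an exponential tail bound for its sum of squares around the mean
(`measureReal_abs_sum_sq_sub_ge_le`). Polarization and a union bound over the `p²` entries show
that, with probability tending to one, every entry of the Gram matrix is within a multiple of
`√(log p / n)` of the stationary covariance `Γ`, and every correlation of the design with the noise
is of that order. Moreover `m ≤ Γ ≤ M / m`. Since `s log p / √n → 0`, the entrywise error remains
negligible when multiplied by the sparsity `s`, so that the sparse Riesz condition follows from
`|vᵀ (XᵀX / n - Γ) v| ≤ δ ‖v‖₁²` without any covering argument.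

*Sparsity of the Lasso.* The error `h` of the Lasso lies in a cone `‖h‖₁ ≤ 3 ‖h_S‖₁`, on which the
same entrywise bound gives a restricted eigenvalue condition; thus `‖X h‖² / n` is at most a
multiple of `lam² s`. By the optimality conditions each selected variable has a correlation of at
least `3 lam / 4` with `X h`, and the upper sparse eigenvalue bounds the number of such variables
(`IsLasso.numNonzero_le`).
-/

/-! ### Stable linear recursions and the transfer function -/

section LinearAlgebra

open Polynomial in
/-- Parseval's identity for a polynomial, summed over an initial segment of exponents. -/
lemma sum_range_sq_norm_coeff_eq_circleAverage (q : ℂ[X]) (N : ℕ)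
    (h : ∀ k, N ≤ k → q.coeff k = 0) :
    ∑ k ∈ Finset.range N, ‖q.coeff k‖ ^ 2 = Real.circleAverage (fun z => ‖q.eval z‖ ^ 2) 0 1 := by
  rw [← Polynomial.sum_sq_norm_coeff_eq_circleAverage]
  refine (Finset.sum_subset (fun k hk => ?_) (fun k _ hk => ?_)).symm
  · by_contra hkN
    exact (mem_support_iff.1 hk) (h k (by simpa using hkN))
  · simp [notMem_support_iff.1 hk]

open Matrix in
/-- The lower bound on the transfer function passes from `A` to `Aᵀ`: a square matrix and its
conjugate transpose have the same smallest singular value. -/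
lemma transfer_lower_transpose {p : ℕ} {A : Matrix (Fin p) (Fin p) ℝ} {m : ℝ} (hm : 0 < m)
    (hA : ∀ z : ℂ, ‖z‖ = 1 → ∀ v : Fin p → ℂ,
      m * ∑ j, ‖v j‖ ^ 2 ≤ ∑ j, ‖((1 - z • A.map (fun x : ℝ => (x : ℂ))).mulVec v) j‖ ^ 2)
    (z : ℂ) (hz : ‖z‖ = 1) (v : Fin p → ℂ) :
    m * ∑ j, ‖v j‖ ^ 2 ≤
      ∑ j, ‖((1 - z • Aᵀ.map (fun x : ℝ => (x : ℂ))).mulVec v) j‖ ^ 2 := by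
  set N : Matrix (Fin p) (Fin p) ℂ := 1 - (starRingEnd ℂ z) • A.map (fun x : ℝ => (x : ℂ)) with hN
  have hNH : Nᴴ = 1 - z • Aᵀ.map (fun x : ℝ => (x : ℂ)) := by
    ext i j
    simp [hN, Matrix.conjTranspose_apply, Matrix.one_apply, eq_comm, apply_ite]
  rw [← hNH]
  have hlow := hA (starRingEnd ℂ z) (by simpa using hz)
  rw [← hN] at hlow
  have hinj : Function.Injective N.mulVec := by
    rw [← Matrix.coe_mulVecLin, ← LinearMap.ker_eq_bot, LinearMap.ker_eq_bot']
    intro x hx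
    have h1 := hlow x
    rw [Matrix.mulVecLin_apply] at hx
    rw [hx] at h1
    simp only [Pi.zero_apply, norm_zero, ne_eq, OfNat.ofNat_ne_zero, not_false_eq_true, zero_pow,
      Finset.sum_const_zero] at h1
    have h2 : ∑ j, ‖x j‖ ^ 2 = 0 :=
      le_antisymm (by nlinarith) (Finset.sum_nonneg fun _ _ => by positivity)
    funext j
    have := (Finset.sum_eq_zero_iff_of_nonneg (fun _ _ => by positivity)).1 h2 j (Finset.mem_univ _)
    simpa using this
  obtain ⟨x, hx⟩ : ∃ x, N.mulVec x = v := by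
    have := LinearMap.surjective_of_injective (f := N.mulVecLin) hinj
    simpa using this v
  have hx2 := hlow x
  rw [hx] at hx2
  -- `‖v‖² = ⟪Nᴴ v, x⟫ ≤ ‖Nᴴ v‖ ‖x‖`, where `v = N x`
  have key : (∑ j, ‖v j‖ ^ 2 : ℝ) ≤ ∑ j, ‖(Nᴴ.mulVec v) j‖ * ‖x j‖ := by
    have h1 : star v ⬝ᵥ v = star (Nᴴ.mulVec v) ⬝ᵥ x := by
      rw [Matrix.star_mulVec, Matrix.conjTranspose_conjTranspose, ← Matrix.dotProduct_mulVec, hx]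
    have h2 : star v ⬝ᵥ v = ((∑ j, ‖v j‖ ^ 2 : ℝ) : ℂ) := by
      simp [dotProduct, ← Complex.conj_mul']
    have h3 : (∑ j, ‖v j‖ ^ 2 : ℝ) = ‖star v ⬝ᵥ v‖ := by
      rw [h2, Complex.norm_real, Real.norm_of_nonneg (Finset.sum_nonneg fun _ _ => by positivity)]
    rw [h3, h1]
    refine (norm_sum_le _ _).trans (le_of_eq ?_)
    simp
  have cs := Finset.sum_mul_sq_le_sq_mul_sq Finset.univ (fun j => ‖(Nᴴ.mulVec v) j‖)
    (fun j => ‖x j‖)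
  set S := ∑ j, ‖v j‖ ^ 2
  set T := ∑ j, ‖(Nᴴ.mulVec v) j‖ ^ 2
  set U := ∑ j, ‖x j‖ ^ 2
  have hS : 0 ≤ S := Finset.sum_nonneg fun _ _ => by positivity
  have hT : 0 ≤ T := Finset.sum_nonneg fun _ _ => by positivity
  have h4 : S ^ 2 ≤ T * U := (pow_le_pow_left₀ hS key 2).trans cs
  rcases hS.eq_or_lt with h0 | h0
  · rw [← h0]; simpa using hT
  · have h5 : m * S ^ 2 ≤ T * S := by
      calc m * S ^ 2 ≤ m * (T * U) := by gcongr
        _ = T * (m * U) := by ring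
        _ ≤ T * S := by gcongr
    nlinarith

open Polynomial Matrix in
/-- The lower bound on the transfer function in the time domain, for finitely supported
sequences: pointwise on the unit circle it bounds `∑ u k z ^ k`, and Parseval's identity
integrates it over the circle. -/
lemma sum_sq_le_of_transfer_lower {p : ℕ} {B : Matrix (Fin p) (Fin p) ℝ} {m : ℝ}
    (hB : ∀ z : ℂ, ‖z‖ = 1 → ∀ v : Fin p → ℂ,
      m * ∑ j, ‖v j‖ ^ 2 ≤ ∑ j, ‖((1 - z • B.map (fun x : ℝ => (x : ℂ))).mulVec v) j‖ ^ 2)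
    (u : ℕ → Fin p → ℝ) (N : ℕ) (hu : ∀ k, N ≤ k → u k = 0) :
    m * ∑ k ∈ Finset.range N, ∑ j, u k j ^ 2 ≤
      ∑ j, u 0 j ^ 2 + ∑ k ∈ Finset.range N, ∑ j, (u (k + 1) j - (B *ᵥ u k) j) ^ 2 := by
  set P : Fin p → ℂ[X] := fun j => ∑ k ∈ Finset.range N, monomial k (u k j : ℂ) with hP
  set D : Fin p → ℂ[X] := fun j => P j - X * ∑ i, C (B j i : ℂ) * P i with hD
  have hPc : ∀ j k, (P j).coeff k = (u k j : ℂ) := by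
    intro j k
    simp only [hP, finsetSum_coeff, coeff_monomial]
    by_cases hk : k < N
    · simp [hk]
    · simp [hu k (not_lt.1 hk)]
  have hD0 : ∀ j, (D j).coeff 0 = (u 0 j : ℂ) := by
    intro j; simp [hD, hPc]
  have hDs : ∀ j k, (D j).coeff (k + 1) = ((u (k + 1) j - (B *ᵥ u k) j : ℝ) : ℂ) := by
    intro j k
    simp [hD, hPc, Matrix.mulVec, dotProduct]
  have hDe : ∀ z j, (D j).eval z =
      ((1 - z • B.map (fun x : ℝ => (x : ℂ))).mulVec (fun i => (P i).eval z)) j := by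
    intro z j
    simp only [hD, eval_sub, eval_mul, eval_X, eval_finsetSum, eval_C, Matrix.sub_mulVec,
      Matrix.one_mulVec, Pi.sub_apply, Matrix.smul_mulVec, Pi.smul_apply, smul_eq_mul]
    simp [Matrix.mulVec, dotProduct]
  have hint : ∀ q : ℂ[X], CircleIntegrable (fun z => ‖q.eval z‖ ^ 2) 0 1 := fun q =>
    ContinuousOn.circleIntegrable zero_le_one (by fun_prop)
  have h1 : ∑ k ∈ Finset.range N, ∑ j, u k j ^ 2 =
      Real.circleAverage (fun z => ∑ j, ‖(P j).eval z‖ ^ 2) 0 1 := by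
    rw [Real.circleAverage_fun_sum (fun j _ => hint _), Finset.sum_comm]
    refine Finset.sum_congr rfl fun j _ => ?_
    rw [← sum_range_sq_norm_coeff_eq_circleAverage (P j) N (fun k hk => by rw [hPc, hu k hk]; simp)]
    simp [hPc]
  have h2 : ∑ j, u 0 j ^ 2 + ∑ k ∈ Finset.range N, ∑ j, (u (k + 1) j - (B *ᵥ u k) j) ^ 2 =
      Real.circleAverage (fun z => ∑ j, ‖(D j).eval z‖ ^ 2) 0 1 := by
    rw [Real.circleAverage_fun_sum (fun j _ => hint _), Finset.sum_comm, ← Finset.sum_add_distrib]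
    refine Finset.sum_congr rfl fun j _ => ?_
    rw [← sum_range_sq_norm_coeff_eq_circleAverage (D j) (N + 1), Finset.sum_range_succ', hD0,
      add_comm]
    · simp only [hDs, Complex.norm_real, Real.norm_eq_abs, sq_abs]
    · intro k hk
      obtain ⟨k, rfl⟩ : ∃ l, k = l + 1 := ⟨k - 1, by omega⟩
      rw [hDs, hu k (by omega), hu (k + 1) (by omega)]
      simp
  rw [h1, h2, ← smul_eq_mul, ← Real.circleAverage_fun_smul]
  refine Real.circleAverage_mono ?_ ?_ ?_
  · exact ContinuousOn.circleIntegrable zero_le_one (by fun_prop)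
  · exact ContinuousOn.circleIntegrable zero_le_one (by fun_prop)
  · intro z hz
    have := hB z (by simpa using hz) (fun i => (P i).eval z)
    simp only [hDe, smul_eq_mul]
    exact this

/-- In a complex Banach algebra the powers of an element of spectral radius less than one tend to
zero, by Gelfand's formula. -/
lemma tendsto_pow_zero_of_spectralRadius_lt_one {R : Type*} [NormedRing R] [NormedAlgebra ℂ R]
    [CompleteSpace R] (a : R) (ha : spectralRadius ℂ a < 1) :
    Tendsto (fun k : ℕ => a ^ k) atTop (𝓝 0) := by
  obtain ⟨r, hr1, hr2⟩ := ENNReal.lt_iff_exists_nnreal_btwn.1 ha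
  have hr2' : (r : ℝ) < 1 := by exact_mod_cast hr2
  have h := (spectrum.pow_nnnorm_pow_one_div_tendsto_nhds_spectralRadius a).eventually_lt_const hr1
  refine squeeze_zero_norm' ?_ (tendsto_pow_atTop_nhds_zero_of_lt_one r.2 hr2')
  filter_upwards [h, eventually_gt_atTop 0] with k hk hk0
  rw [one_div, ENNReal.rpow_inv_lt_iff (by exact_mod_cast hk0), ENNReal.rpow_natCast] at hk
  exact_mod_cast hk.le

/-- Powers of a real matrix whose complex eigenvalues have modulus less than one tend to zero. -/
lemma tendsto_matrix_pow_zero {p : ℕ} {A : Matrix (Fin p) (Fin p) ℝ}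
    (hA : ∀ z ∈ spectrum ℂ (A.map (fun x : ℝ => (x : ℂ))), ‖z‖ < 1) :
    Tendsto (fun k : ℕ => A ^ k) atTop (𝓝 0) := by
  rcases Nat.eq_zero_or_pos p with rfl | hp
  · exact tendsto_const_nhds.congr fun k => Subsingleton.elim _ _
  have : Nonempty (Fin p) := ⟨⟨0, hp⟩⟩
  let : NormedRing (Matrix (Fin p) (Fin p) ℂ) := Matrix.linftyOpNormedRing
  let : NormedAlgebra ℂ (Matrix (Fin p) (Fin p) ℂ) := Matrix.linftyOpNormedAlgebra
  have : CompleteSpace (Matrix (Fin p) (Fin p) ℂ) := FiniteDimensional.complete ℂ _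
  have h1 : spectralRadius ℂ (A.map (fun x : ℝ => (x : ℂ))) < 1 := by
    have := spectrum.spectralRadius_lt_of_forall_lt (A.map (fun x : ℝ => (x : ℂ))) (r := 1)
      (fun z hz => by exact_mod_cast hA z hz)
    simpa using this
  have h2 := tendsto_pow_zero_of_spectralRadius_lt_one _ h1
  have h3 : ∀ k : ℕ, (A.map (fun x : ℝ => (x : ℂ))) ^ k = (A ^ k).map (fun x : ℝ => (x : ℂ)) :=
    fun k => (map_pow (Complex.ofRealHom.mapMatrix) A k).symm
  have h4 : Continuous fun B : Matrix (Fin p) (Fin p) ℂ => B.map Complex.re :=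
    Continuous.matrix_map continuous_id Complex.continuous_re
  have h5 := (h4.tendsto 0).comp h2
  have h6 : (fun k : ℕ => A ^ k) = (fun B : Matrix (Fin p) (Fin p) ℂ => B.map Complex.re) ∘
      fun k : ℕ => (A.map (fun x : ℝ => (x : ℂ))) ^ k := by
    funext k
    ext i j
    simp [h3]
  rw [h6]
  convert h5 using 2
  ext i j
  simp

open Matrix in
lemma tendsto_transpose_pow_mulVec_zero {p : ℕ} {A : Matrix (Fin p) (Fin p) ℝ}
    (hA : ∀ z ∈ spectrum ℂ (A.map (fun x : ℝ => (x : ℂ))), ‖z‖ < 1) (v : Fin p → ℝ) :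
    Tendsto (fun k : ℕ => (Aᵀ ^ k) *ᵥ v) atTop (𝓝 0) := by
  have h : Continuous fun B : Matrix (Fin p) (Fin p) ℝ => Bᵀ *ᵥ v :=
    continuous_id.matrix_transpose.matrix_mulVec continuous_const
  have h1 := (h.tendsto 0).comp (tendsto_matrix_pow_zero hA)
  simpa [Function.comp_def, Matrix.transpose_pow] using h1

open Matrix in
/-- The adjoint recursion `u t = Aᵀ u (t + 1) + w t`, solved backwards from `u n = 0` and
continued by `Aᵀ` to negative times, is bounded in `ℓ²` by its input `w`. -/
lemma exists_adjoint_solution {p : ℕ} {A : Matrix (Fin p) (Fin p) ℝ} {m : ℝ} (hm : 0 < m)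
    (hA : ∀ z ∈ spectrum ℂ (A.map (fun x : ℝ => (x : ℂ))), ‖z‖ < 1)
    (htr : ∀ z : ℂ, ‖z‖ = 1 → ∀ v : Fin p → ℂ,
      m * ∑ j, ‖v j‖ ^ 2 ≤ ∑ j, ‖((1 - z • A.map (fun x : ℝ => (x : ℂ))).mulVec v) j‖ ^ 2)
    (n : ℕ) (w : ℕ → Fin p → ℝ) :
    ∃ u : ℕ → Fin p → ℝ, u n = 0 ∧ (∀ t < n, u t = Aᵀ *ᵥ u (t + 1) + w t) ∧
      ∀ N, m * (∑ t ∈ Finset.range n, ∑ j, u (t + 1) j ^ 2 +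
        ∑ k ∈ Finset.range N, ∑ j, ((Aᵀ ^ k) *ᵥ u 0) j ^ 2) ≤
          ∑ t ∈ Finset.range n, ∑ j, w t j ^ 2 := by
  -- time is reversed: `r k` stands for `u (n - k)`
  set w' : ℕ → Fin p → ℝ := fun k => if k < n then w (n - 1 - k) else 0 with hw'
  set r : ℕ → Fin p → ℝ := fun k => Nat.rec 0 (fun k x => Aᵀ *ᵥ x + w' k) k with hr
  have hr0 : r 0 = 0 := rfl
  have hrs : ∀ k, r (k + 1) = Aᵀ *ᵥ r k + w' k := fun k => rfl
  have hrn : ∀ k, r (n + k) = (Aᵀ ^ k) *ᵥ r n := by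
    intro k
    induction k with
    | zero => simp
    | succ k ih =>
      rw [← add_assoc, hrs, ih, pow_succ', ← Matrix.mulVec_mulVec]
      simp [hw']
  have hwsum : ∀ K, ∑ k ∈ Finset.range (n + K), ∑ j, w' k j ^ 2 =
      ∑ t ∈ Finset.range n, ∑ j, w t j ^ 2 := by
    intro K
    rw [Finset.sum_range_add, ← Finset.sum_range_reflect (fun t => ∑ j, w t j ^ 2)]
    have : ∑ k ∈ Finset.range K, ∑ j, w' (n + k) j ^ 2 = 0 :=
      Finset.sum_eq_zero fun k _ => by simp [hw']
    rw [this, add_zero]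
    refine Finset.sum_congr rfl fun k hk => ?_
    simp [hw', Finset.mem_range.1 hk]
  have hfin : ∀ K, m * ∑ k ∈ Finset.range (n + K + 1), ∑ j, r k j ^ 2 ≤
      ∑ t ∈ Finset.range n, ∑ j, w t j ^ 2 + ∑ j, ((Aᵀ ^ (K + 1)) *ᵥ r n) j ^ 2 := by
    intro K
    have h := sum_sq_le_of_transfer_lower (transfer_lower_transpose hm htr)
      (fun k => if k < n + K + 1 then r k else 0) (n + K + 1) (fun k hk => by simp [not_lt.2 hk])
    have e1 : ∑ k ∈ Finset.range (n + K + 1), ∑ j,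
        (if k < n + K + 1 then r k else 0) j ^ 2 =
        ∑ k ∈ Finset.range (n + K + 1), ∑ j, r k j ^ 2 :=
      Finset.sum_congr rfl fun k hk => by rw [if_pos (Finset.mem_range.1 hk)]
    rw [e1, Finset.sum_range_succ (fun k => ∑ j, (_ - _) ^ 2)] at h
    refine h.trans (le_of_eq ?_)
    rw [if_pos (show 0 < n + K + 1 by omega), hr0, ← hwsum K, if_neg (lt_irrefl (n + K + 1)),
      if_pos (show n + K < n + K + 1 by omega), hrn, pow_succ',
      ← Matrix.mulVec_mulVec]
    simp only [Pi.zero_apply, ne_eq, OfNat.ofNat_ne_zero, not_false_eq_true, zero_pow,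
      Finset.sum_const_zero, zero_add, zero_sub, neg_sq]
    congr 1
    refine Finset.sum_congr rfl fun k hk => ?_
    have := Finset.mem_range.1 hk
    rw [if_pos (by omega), if_pos (by omega), hrs]
    simp
  refine ⟨fun t => r (n - t), by simp [hr0], fun t ht => ?_, fun N => ?_⟩
  · have e : n - t = n - (t + 1) + 1 := by omega
    have e2 : n - 1 - (n - (t + 1)) = t := by omega
    simp only
    rw [e, hrs]
    simp only [hw']
    rw [if_pos (by omega), e2]
  · have hlim : Tendsto (fun K => ∑ t ∈ Finset.range n, ∑ j, w t j ^ 2 +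
        ∑ j, ((Aᵀ ^ (K + 1)) *ᵥ r n) j ^ 2) atTop
        (𝓝 (∑ t ∈ Finset.range n, ∑ j, w t j ^ 2 + 0)) := by
      refine tendsto_const_nhds.add ?_
      have h1 := (tendsto_transpose_pow_mulVec_zero hA (r n)).comp (tendsto_add_atTop_nat 1)
      have h2 : Continuous fun x : Fin p → ℝ => ∑ j, x j ^ 2 := by fun_prop
      simpa [Function.comp_def] using (h2.tendsto 0).comp h1
    rw [add_zero] at hlim
    refine ge_of_tendsto hlim ?_
    filter_upwards [eventually_ge_atTop N] with K hK
    refine le_trans ?_ (hfin K)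
    refine mul_le_mul_of_nonneg_left ?_ hm.le
    rw [add_assoc n K 1, Finset.sum_range_add]
    refine add_le_add (le_of_eq ?_) ?_
    · rw [← Finset.sum_range_reflect (fun k => ∑ j, r k j ^ 2)]
      refine Finset.sum_congr rfl fun t _ => ?_
      rw [show n - 1 - t = n - (t + 1) by omega]
    · simp only [hrn, Nat.sub_zero]
      exact Finset.sum_le_sum_of_subset_of_nonneg (Finset.range_mono (by omega))
        fun _ _ _ => Finset.sum_nonneg fun _ _ => sq_nonneg _

end LinearAlgebra

/-! ### Concentration of Gaussian quadratic forms -/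

section Chaos

open Real in
/-- `(1 - 2 x) ^ (-1/2) ≤ exp (x + 2 x²)` for `|x| ≤ 1 / 4`, in squared form. -/
lemma one_le_one_sub_two_mul_mul_exp {x : ℝ} (hx : |x| ≤ 1 / 4) :
    1 ≤ (1 - 2 * x) * exp (x + 2 * x ^ 2) ^ 2 := by
  obtain ⟨h1, h2⟩ := abs_le.1 hx
  rw [← exp_nat_mul]
  rcases le_total 0 x with h | h
  · have := quadratic_le_exp_of_nonneg (x := (2 : ℕ) * (x + 2 * x ^ 2)) (by positivity)
    push_cast at this ⊢
    have h3 : 1 ≤ (1 - 2 * x) * (1 + 2 * (x + 2 * x ^ 2) + (2 * (x + 2 * x ^ 2)) ^ 2 / 2) := by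
      have e : (1 - 2 * x) * (1 + 2 * (x + 2 * x ^ 2) + (2 * (x + 2 * x ^ 2)) ^ 2 / 2) =
          1 + x ^ 2 * (2 - 4 * x - 8 * x ^ 2 - 16 * x ^ 3) := by ring
      have h4 : x ^ 2 ≤ (1 / 4) ^ 2 := pow_le_pow_left₀ h h2 2
      have h5 : x ^ 3 ≤ (1 / 4) ^ 3 := pow_le_pow_left₀ h h2 3
      rw [e]
      have := mul_nonneg (sq_nonneg x) (by linarith : 0 ≤ 2 - 4 * x - 8 * x ^ 2 - 16 * x ^ 3)
      linarith
    exact h3.trans (mul_le_mul_of_nonneg_left this (by linarith))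
  · have := add_one_le_exp ((2 : ℕ) * (x + 2 * x ^ 2))
    push_cast at this ⊢
    have h3 : 1 ≤ (1 - 2 * x) * (2 * (x + 2 * x ^ 2) + 1) := by
      nlinarith [mul_nonneg (mul_nonneg (neg_nonneg.2 h) (neg_nonneg.2 h)) (neg_nonneg.2 h)]
    exact h3.trans (mul_le_mul_of_nonneg_left this (by linarith))

open Real NNReal in
/-- The square of a centred Gaussian variable of variance `v` has an exponential moment at `s`,
bounded by `exp (s v + 2 s² v²)`, as long as `|s| v ≤ 1 / 4`. -/
lemma integrable_exp_mul_sq_gaussianReal (v : ℝ≥0) {s : ℝ} (hs : |s| * v ≤ 1 / 4) :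
    Integrable (fun x => exp (s * x ^ 2)) (gaussianReal 0 v) ∧
      ∫ x, exp (s * x ^ 2) ∂(gaussianReal 0 v) ≤ exp (s * v + 2 * (s * v) ^ 2) := by
  by_cases hv : v = 0
  · subst hv
    simp only [gaussianReal_zero_var]
    exact ⟨integrable_dirac (by simp), by simp⟩
  have hv0 : (0 : ℝ) < v := by positivity
  have hsv : |s * v| ≤ 1 / 4 := by rwa [abs_mul, abs_of_pos hv0]
  have hsv' := (abs_le.1 hsv).2
  set b : ℝ := 1 / (2 * v) - s with hb
  have hbv : 2 * v * b = 1 - 2 * (s * v) := by rw [hb]; field_simp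
  have hb0 : 0 < b := by
    have : 0 < 2 * (v : ℝ) * b := by rw [hbv]; linarith
    exact pos_of_mul_pos_right this (by positivity)
  have hpdf : ∀ x : ℝ, gaussianPDFReal 0 v x * exp (s * x ^ 2) =
      (√(2 * π * v))⁻¹ * exp (-b * x ^ 2) := by
    intro x
    rw [gaussianPDFReal, mul_assoc, ← exp_add]
    congr 2
    rw [hb]; field_simp; ring
  constructor
  · rw [gaussianReal_of_var_ne_zero _ hv, integrable_withDensity_iff_integrable_smul'
      (measurable_gaussianPDF 0 v) (ae_of_all _ fun x => gaussianPDF_lt_top)]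
    simp only [toReal_gaussianPDF, smul_eq_mul, hpdf]
    exact (integrable_exp_neg_mul_sq hb0).const_mul _
  · rw [integral_gaussianReal_eq_integral_smul hv]
    simp only [smul_eq_mul, hpdf]
    rw [integral_const_mul, integral_gaussian, inv_mul_eq_div, ← Real.sqrt_div (by positivity),
      Real.sqrt_le_left (exp_pos _).le]
    have h1 : π / b / (2 * π * v) = (1 - 2 * (s * v))⁻¹ := by
      rw [← hbv]; field_simp
    rw [h1, inv_le_iff_one_le_mul₀' (by linarith)]
    exact one_le_one_sub_two_mul_mul_exp hsv

variable {Ω : Type*} {mΩ : MeasurableSpace Ω} {P : Measure Ω} {n : ℕ}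

open Real NNReal in
/-- A vector all of whose linear functionals are centred Gaussian is jointly Gaussian, hence so is
every linear image of it. -/
lemma hasGaussianLaw_linear_image {G : Fin n → Ω → ℝ} (hG : ∀ t, Measurable (G t))
    (h : ∀ c : Fin n → ℝ, ∃ v : ℝ≥0, P.map (fun ω => ∑ t, c t * G t ω) = gaussianReal 0 v)
    {ι : Type*} [Fintype ι] (b : ι → Fin n → ℝ) :
    HasGaussianLaw (fun ω k => ∑ t, b k t * G t ω) P where
  isGaussian_map := by
    classical
    refine isGaussian_of_map_eq_gaussianReal fun L => ?_
    obtain ⟨v, hv⟩ := h (fun t => ∑ k, L (Pi.single k 1) * b k t)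
    refine ⟨0, v, ?_⟩
    rw [Measure.map_map L.continuous.measurable (by fun_prop), ← hv]
    congr 1
    funext ω
    have : (fun k => ∑ t, b k t * G t ω) =
        ∑ k, (∑ t, b k t * G t ω) • (Pi.single k (1 : ℝ) : ι → ℝ) := by
      funext k
      simp [Finset.sum_apply, Pi.single_apply]
    rw [Function.comp_apply, this, map_sum]
    simp only [map_smul, smul_eq_mul, Finset.sum_mul]
    rw [Finset.sum_comm]
    exact Finset.sum_congr rfl fun _ _ => Finset.sum_congr rfl fun _ _ => by ring

open Real NNReal in
lemma integral_sq_of_map_eq_gaussianReal {X : Ω → ℝ} (hX : AEMeasurable X P) {v : ℝ≥0}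
    (h : P.map X = gaussianReal 0 v) : ∫ ω, X ω ^ 2 ∂P = v := by
  have h1 := variance_fun_id_gaussianReal (μ := 0) (v := v)
  rw [variance_of_integral_eq_zero (by fun_prop) (by simp)] at h1
  rw [← h1, ← h, integral_map hX (by fun_prop)]

open Real NNReal in
/-- In an orthonormal eigenbasis of the covariance, the coordinates of a centred Gaussian vector
are independent, and the sum of squares is unchanged. -/
lemma exists_iIndepFun_sum_sq_eq [IsProbabilityMeasure P] {G : Fin n → Ω → ℝ}
    (hG : ∀ t, Measurable (G t)) {K : ℝ}
    (h : ∀ c : Fin n → ℝ, ∃ v : ℝ≥0, (v : ℝ) ≤ K * ∑ t, c t ^ 2 ∧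
      P.map (fun ω => ∑ t, c t * G t ω) = gaussianReal 0 v) :
    ∃ (Z : Fin n → Ω → ℝ) (v : Fin n → ℝ≥0), (∀ k, Measurable (Z k)) ∧ iIndepFun Z P ∧
      (∀ k, P.map (Z k) = gaussianReal 0 (v k)) ∧ (∀ k, (v k : ℝ) ≤ K) ∧
      ∀ ω, ∑ k, Z k ω ^ 2 = ∑ t, G t ω ^ 2 := by
  have hGL := hasGaussianLaw_linear_image hG (fun c => (h c).imp fun _ hv => hv.2) (ι := Fin n)
  have hL2 : ∀ t, MemLp (G t) 2 P := fun t => by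
    have := (hGL (fun k => (Pi.single k 1 : Fin n → ℝ))).eval
      (X := fun k ω => ∑ s, (Pi.single k 1 : Fin n → ℝ) s * G s ω) t
    simpa [Pi.single_apply] using this.memLp_two
  set T : Matrix (Fin n) (Fin n) ℝ := fun s t => cov[G s, G t; P] with hT
  have hTH : T.IsHermitian := by
    ext s t
    exact covariance_comm _ _
  set e := hTH.eigenvectorBasis with he
  choose v hvK hv using fun k => h (e k)
  refine ⟨fun k ω => ∑ t, e k t * G t ω, v, fun k => by fun_prop, ?_, hv, fun k => ?_, fun ω => ?_⟩
  · refine (hGL (fun k => (e k : Fin n → ℝ))).iIndepFun_of_covariance_eq_zero fun k l hkl => ?_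
    rw [covariance_fun_sum_fun_sum (fun t => (hL2 t).const_mul _) (fun t => (hL2 t).const_mul _)]
    simp only [covariance_const_mul_left, covariance_const_mul_right]
    have h1 := hTH.mulVec_eigenvectorBasis l
    have h2 : ∀ s, ∑ t, T s t * e l t = hTH.eigenvalues l * e l s := fun s => by
      simpa [Matrix.mulVec, dotProduct] using congrFun h1 s
    have h3 : inner ℝ (e k) (e l) = 0 := e.orthonormal.2 hkl
    rw [PiLp.inner_apply] at h3
    calc ∑ s, ∑ t, e l t * (e k s * cov[G s, G t; P])
        = ∑ s, e k s * ∑ t, T s t * e l t := by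
          refine Finset.sum_congr rfl fun s _ => ?_
          rw [Finset.mul_sum]
          exact Finset.sum_congr rfl fun t _ => by simp only [hT]; ring
      _ = hTH.eigenvalues l * ∑ s, inner ℝ (e k s) (e l s) := by
          rw [Finset.mul_sum]
          refine Finset.sum_congr rfl fun s _ => ?_
          rw [h2]
          simp
          ring
      _ = 0 := by rw [h3, mul_zero]
  · have h1 : ∑ t, e k t ^ 2 = 1 := by
      have := e.orthonormal.1 k
      rw [← EuclideanSpace.real_norm_sq_eq, this, one_pow]
    simpa [h1] using hvK k
  · have h1 := e.sum_sq_inner_right (WithLp.toLp 2 fun t => G t ω)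
    rw [EuclideanSpace.real_norm_sq_eq] at h1
    simp only [PiLp.inner_apply] at h1
    simpa [mul_comm] using h1

open Real NNReal in
/-- A Hanson–Wright bound: the sum of squares of a centred Gaussian vector whose covariance has
operator norm at most `K`. -/
lemma measureReal_abs_sum_sq_sub_ge_le [IsProbabilityMeasure P] {G : Fin n → Ω → ℝ}
    (hG : ∀ t, Measurable (G t)) {K : ℝ} (hK : 0 < K)
    (h : ∀ c : Fin n → ℝ, ∃ v : ℝ≥0, (v : ℝ) ≤ K * ∑ t, c t ^ 2 ∧
      P.map (fun ω => ∑ t, c t * G t ω) = gaussianReal 0 v) {η : ℝ} (hη : 0 ≤ η) (hηK : η ≤ K) :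
    P.real {ω | n * η ≤ |∑ t, G t ω ^ 2 - ∑ t, ∫ ω', G t ω' ^ 2 ∂P|} ≤
      2 * exp (-(n * η ^ 2 / (8 * K ^ 2))) := by
  obtain ⟨Z, v, hZm, hZi, hZv, hvK, hZG⟩ := exists_iIndepFun_sum_sq_eq hG h
  have hmean : ∑ t, ∫ ω', G t ω' ^ 2 ∂P = ∑ k, (v k : ℝ) := by
    have hint : ∀ X : Ω → ℝ, Measurable X → (∃ v : ℝ≥0, P.map X = gaussianReal 0 v) →
        Integrable (fun ω => X ω ^ 2) P := by
      rintro X hX ⟨v, hv⟩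
      have h2 : MemLp id 2 (P.map X) := hv ▸ memLp_id_gaussianReal 2
      exact ((memLp_map_measure_iff (by fun_prop) hX.aemeasurable).1 h2).integrable_sq
    have hGv : ∀ t, ∃ v : ℝ≥0, P.map (G t) = gaussianReal 0 v := fun t => by
      obtain ⟨v, -, hv⟩ := h (Pi.single t 1)
      exact ⟨v, by simpa [Pi.single_apply] using hv⟩
    rw [← integral_finsetSum _ (fun t _ => hint _ (hG t) (hGv t))]
    simp only [← hZG]
    rw [integral_finsetSum _ (fun k _ => hint _ (hZm k) ⟨_, hZv k⟩)]
    exact Finset.sum_congr rfl fun k _ => integral_sq_of_map_eq_gaussianReal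
      (hZm k).aemeasurable (hZv k)
  set W : Fin n → Ω → ℝ := fun k ω => Z k ω ^ 2 with hW
  have hWm : ∀ k, Measurable (W k) := fun k => (hZm k).pow_const 2
  have hWi : iIndepFun W P := hZi.comp (fun _ x => x ^ 2) (fun _ => by fun_prop)
  have hone : ∀ s : ℝ, |s| * K ≤ 1 / 4 → ∀ k, Integrable (fun ω => exp (s * W k ω)) P ∧
      mgf (W k) P s ≤ exp (s * v k + 2 * (s * v k) ^ 2) := by
    intro s hs k
    have hsv : |s| * v k ≤ 1 / 4 :=
      (mul_le_mul_of_nonneg_left (hvK k) (abs_nonneg s)).trans hs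
    obtain ⟨h1, h2⟩ := integrable_exp_mul_sq_gaussianReal (v k) hsv
    rw [← hZv k] at h1 h2
    refine ⟨h1.comp_measurable (hZm k), ?_⟩
    rwa [integral_map (hZm k).aemeasurable (by fun_prop)] at h2
  have hsum : ∀ s : ℝ, |s| * K ≤ 1 / 4 →
      Integrable (fun ω => exp (s * (∑ k, W k) ω)) P ∧
      mgf (∑ k, W k) P s ≤ exp (s * ∑ k, (v k : ℝ) + n * (2 * s ^ 2 * K ^ 2)) := by
    intro s hs
    refine ⟨hWi.integrable_exp_mul_sum hWm fun k _ => (hone s hs k).1, ?_⟩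
    rw [hWi.mgf_sum hWm]
    calc ∏ k, mgf (W k) P s ≤ ∏ k, exp (s * v k + 2 * s ^ 2 * K ^ 2) := by
          refine Finset.prod_le_prod (fun _ _ => mgf_nonneg) fun k _ => (hone s hs k).2.trans ?_
          rw [exp_le_exp, mul_pow, ← mul_assoc]
          have := pow_le_pow_left₀ (v k).2 (hvK k) 2
          gcongr
          exact hvK k
      _ = _ := by
          rw [← exp_sum, Finset.sum_add_distrib, Finset.mul_sum]
          simp
  -- Chernoff's bound at `s = ± η / (4 K²)`
  set s : ℝ := η / (4 * K ^ 2) with hs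
  have hs0 : 0 ≤ s := by positivity
  have hsK : s * K ≤ 1 / 4 := by
    have : s * K = η / K / 4 := by rw [hs]; field_simp
    rw [this]
    have := (div_le_one hK).2 hηK
    linarith
  have hexp : ∀ V : ℝ, exp (-s * (V + n * η)) * exp (s * V + n * (2 * s ^ 2 * K ^ 2)) =
      exp (-(n * η ^ 2 / (8 * K ^ 2))) := by
    intro V
    rw [← exp_add, hs]
    congr 1
    field_simp
    ring
  have hup := measure_ge_le_exp_mul_mgf (∑ k, (v k : ℝ) + n * η) hs0
    (hsum s (by rwa [abs_of_nonneg hs0])).1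
  have hlo := measure_le_le_exp_mul_mgf (∑ k, (v k : ℝ) - n * η) (neg_nonpos.2 hs0)
    (hsum (-s) (by rwa [abs_neg, abs_of_nonneg hs0])).1
  have hup' := hup.trans (mul_le_mul_of_nonneg_left
    (hsum s (by rwa [abs_of_nonneg hs0])).2 (exp_pos _).le)
  have hlo' := hlo.trans (mul_le_mul_of_nonneg_left
    (hsum (-s) (by rwa [abs_neg, abs_of_nonneg hs0])).2 (exp_pos _).le)
  rw [hexp] at hup'
  rw [show exp (- -s * (∑ k, (v k : ℝ) - n * η)) *
    exp (-s * ∑ k, (v k : ℝ) + n * (2 * (-s) ^ 2 * K ^ 2)) =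
      exp (-s * (-∑ k, (v k : ℝ) + n * η)) *
        exp (s * (-∑ k, (v k : ℝ)) + n * (2 * s ^ 2 * K ^ 2)) by
    rw [← exp_add, ← exp_add]; ring_nf, hexp] at hlo'
  rw [hmean]
  refine (measureReal_mono (s₂ := {ω | ∑ k, (v k : ℝ) + n * η ≤ (∑ k, W k) ω} ∪
    {ω | (∑ k, W k) ω ≤ ∑ k, (v k : ℝ) - n * η}) ?_).trans ?_
  · intro ω hω
    simp only [Set.mem_ofPred_eq, ← hZG, le_abs] at hω
    simp only [Set.mem_union, Set.mem_ofPred_eq, Finset.sum_apply, hW]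
    rcases hω with hω | hω
    · left; linarith
    · right; linarith
  · refine (measureReal_union_le _ _).trans ?_
    linarith

end Chaos

/-! ### Linear functionals of the trajectory -/

namespace GaussianVAR

open Matrix

variable (V : GaussianVAR.{u})

/-- The variance `uᵀ Σ u` of the functional `u` of an innovation. -/
noncomputable def noiseForm (u : Fin V.p → ℝ) : ℝ := u ⬝ᵥ V.Sig *ᵥ u

/-- The variance `uᵀ Γ u` of the functional `u` under the stationary law, as the series
`∑ uᵀ Aᵏ Σ (Aᵏ)ᵀ u`. -/
noncomputable def statForm (u : Fin V.p → ℝ) : ℝ := ∑' k : ℕ, V.noiseForm ((V.Aᵀ ^ k) *ᵥ u)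

variable {V} {m M : ℝ}

lemma noiseForm_nonneg (u : Fin V.p → ℝ) : 0 ≤ V.noiseForm u := by
  simpa [noiseForm] using V.sig_posSemidef.dotProduct_mulVec_nonneg u

lemma noiseForm_neg (u : Fin V.p → ℝ) : V.noiseForm (-u) = V.noiseForm u := by
  simp [noiseForm, Matrix.mulVec_neg]

lemma DependenceBounds.noiseForm_add_le (hV : V.DependenceBounds m M) (hM : 0 ≤ M)
    (u v : Fin V.p → ℝ) :
    V.noiseForm (u + v) ≤ 2 * M * ∑ j, u j ^ 2 + 2 * M * ∑ j, v j ^ 2 := by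
  refine (hV.sig_upper _).trans ?_
  calc M * ∑ j, (u + v) j ^ 2 ≤ M * ∑ j, (2 * u j ^ 2 + 2 * v j ^ 2) := by
        refine mul_le_mul_of_nonneg_left (Finset.sum_le_sum fun j _ => ?_) hM
        have := sq_nonneg (u j - v j)
        simp only [Pi.add_apply]
        nlinarith
    _ = _ := by rw [Finset.sum_add_distrib, ← Finset.mul_sum, ← Finset.mul_sum]; ring

lemma DependenceBounds.le (hV : V.DependenceBounds m M) (i : Fin V.p) : m ≤ M := by
  have h := (hV.sig_lower (Pi.single i 1)).trans (hV.sig_upper (Pi.single i 1))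
  simpa [Pi.single_apply] using h

lemma DependenceBounds.sum_range_noiseForm_le (hV : V.DependenceBounds m M) (hm : 0 < m)
    (hM : 0 ≤ M) (u : Fin V.p → ℝ) (N : ℕ) :
    ∑ k ∈ Finset.range N, V.noiseForm ((V.Aᵀ ^ k) *ᵥ u) ≤ M / m * ∑ j, u j ^ 2 := by
  obtain ⟨x, h1, h2, h3⟩ := exists_adjoint_solution hm V.stable hV.transfer_lower 1 (fun _ => u)
  have h0 : x 0 = u := by rw [h2 0 one_pos, zero_add, h1]; simp
  have h4 := h3 N
  simp only [Finset.range_one, Finset.sum_singleton, zero_add, h1, h0, Pi.zero_apply, ne_eq,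
    OfNat.ofNat_ne_zero, not_false_eq_true, zero_pow, Finset.sum_const_zero] at h4
  calc ∑ k ∈ Finset.range N, V.noiseForm ((V.Aᵀ ^ k) *ᵥ u)
      ≤ ∑ k ∈ Finset.range N, M * ∑ j, ((V.Aᵀ ^ k) *ᵥ u) j ^ 2 :=
        Finset.sum_le_sum fun k _ => hV.sig_upper _
    _ = M / m * (m * ∑ k ∈ Finset.range N, ∑ j, ((V.Aᵀ ^ k) *ᵥ u) j ^ 2) := by
        rw [← Finset.mul_sum]; field_simp
    _ ≤ _ := by gcongr

lemma DependenceBounds.summable_noiseForm (hV : V.DependenceBounds m M) (hm : 0 < m)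
    (hM : 0 ≤ M) (u : Fin V.p → ℝ) :
    Summable fun k : ℕ => V.noiseForm ((V.Aᵀ ^ k) *ᵥ u) :=
  summable_of_sum_range_le (fun _ => noiseForm_nonneg _) (hV.sum_range_noiseForm_le hm hM u)

lemma statForm_nonneg (u : Fin V.p → ℝ) : 0 ≤ V.statForm u :=
  tsum_nonneg fun _ => noiseForm_nonneg _

lemma DependenceBounds.statForm_le (hV : V.DependenceBounds m M) (hm : 0 < m)
    (hM : 0 ≤ M) (u : Fin V.p → ℝ) : V.statForm u ≤ M / m * ∑ j, u j ^ 2 :=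
  (hV.summable_noiseForm hm hM u).tsum_le_of_sum_range_le (hV.sum_range_noiseForm_le hm hM u)

lemma DependenceBounds.le_statForm (hV : V.DependenceBounds m M) (hm : 0 < m)
    (hM : 0 ≤ M) (u : Fin V.p → ℝ) : m * ∑ j, u j ^ 2 ≤ V.statForm u := by
  refine (hV.sig_lower u).trans ?_
  have := (hV.summable_noiseForm hm hM u).sum_le_tsum (Finset.range 1)
    (fun _ _ => noiseForm_nonneg _)
  simpa [noiseForm, statForm] using this

/-- Summation by parts along the recursion: if `u t = Aᵀ u (t + 1) + w t`, then the functional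
`∑ w t ⬝ y t` of the trajectory is one of `y 0` and the innovations, up to a boundary term. -/
lemma sum_dotProduct_y {ω : V.Ω}
    (hω : ∀ t j, V.y (t + 1) ω j = (V.A.mulVec (V.y t ω)) j + V.e (t + 1) ω j)
    {u w : ℕ → Fin V.p → ℝ} {n : ℕ} (h : ∀ t < n, u t = V.Aᵀ *ᵥ u (t + 1) + w t) :
    ∑ t ∈ Finset.range n, w t ⬝ᵥ V.y t ω + u n ⬝ᵥ V.y n ω =
      u 0 ⬝ᵥ V.y 0 ω + ∑ t ∈ Finset.range n, u (t + 1) ⬝ᵥ V.e (t + 1) ω := by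
  induction n with
  | zero => simp
  | succ n ih =>
    have h1 := ih fun t ht => h t (by omega)
    have h2 : u (n + 1) ⬝ᵥ V.y (n + 1) ω =
        (V.Aᵀ *ᵥ u (n + 1)) ⬝ᵥ V.y n ω + u (n + 1) ⬝ᵥ V.e (n + 1) ω := by
      have : (V.y (n + 1) ω : Fin V.p → ℝ) = V.A *ᵥ V.y n ω + V.e (n + 1) ω := funext (hω n)
      rw [this, dotProduct_add, Matrix.dotProduct_mulVec, Matrix.mulVec_transpose]
    rw [Finset.sum_range_succ, Finset.sum_range_succ, h2, ← add_assoc (u 0 ⬝ᵥ _), ← h1,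
      h n (by omega), add_dotProduct]
    ring

lemma ae_recursion (V : GaussianVAR.{u}) : ∀ᵐ ω ∂V.μ, ∀ t j,
    V.y (t + 1) ω j = (V.A.mulVec (V.y t ω)) j + V.e (t + 1) ω j :=
  ae_all_iff.2 V.recursion

lemma measurable_dotProduct_y (u : Fin V.p → ℝ) (t : ℕ) :
    Measurable fun ω => u ⬝ᵥ V.y t ω := by
  have := V.measurable_y t
  unfold dotProduct
  fun_prop

lemma map_dotProduct_y (u : Fin V.p → ℝ) (t : ℕ) :
    V.μ.map (fun ω => u ⬝ᵥ V.y t ω) = V.μ.map (fun ω => u ⬝ᵥ V.y 0 ω) := by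
  have hm : Measurable fun x : EuclideanSpace ℝ (Fin V.p) => u ⬝ᵥ x := by
    unfold dotProduct; fun_prop
  have e : ∀ t, (fun ω => u ⬝ᵥ V.y t ω) =
    (fun x : EuclideanSpace ℝ (Fin V.p) => u ⬝ᵥ x) ∘ V.y t := fun _ => rfl
  rw [e, e, ← Measure.map_map hm (V.measurable_y _), ← Measure.map_map hm (V.measurable_y _),
    V.stationary t]

lemma measurable_dotProduct_e (u : Fin V.p → ℝ) (t : ℕ) :
    Measurable fun ω => u ⬝ᵥ V.e t ω := by
  have := V.measurable_e t
  unfold dotProduct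
  fun_prop

lemma map_dotProduct_e (u : Fin V.p → ℝ) (t : ℕ) :
    V.μ.map (fun ω => u ⬝ᵥ V.e (t + 1) ω) = gaussianReal 0 (V.noiseForm u).toNNReal := by
  have hm : Measurable fun x : EuclideanSpace ℝ (Fin V.p) => u ⬝ᵥ x := by
    unfold dotProduct; fun_prop
  have : (fun ω => u ⬝ᵥ V.e (t + 1) ω) = (fun x : EuclideanSpace ℝ (Fin V.p) => u ⬝ᵥ x) ∘
    V.e (t + 1) := rfl
  rw [this, ← Measure.map_map hm (V.measurable_e _), V.law_e]
  refine Measure.ext_of_charFun ?_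
  ext τ
  rw [charFun_gaussianReal, charFun_apply_real, integral_map hm.aemeasurable (by fun_prop)]
  have h1 := charFun_multivariateGaussian (μ := 0) V.sig_posSemidef (WithLp.toLp 2 (τ • u))
  rw [charFun_apply] at h1
  have h2 : ∀ x : EuclideanSpace ℝ (Fin V.p), inner ℝ x (WithLp.toLp 2 (τ • u)) =
      τ * (u ⬝ᵥ x) := by
    intro x
    simp only [PiLp.inner_apply, dotProduct, Finset.mul_sum]
    exact Finset.sum_congr rfl fun j _ => by simp; ring
  simp only [h2, Complex.ofReal_mul] at h1
  rw [h1]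
  congr 1
  rw [Real.coe_toNNReal _ (noiseForm_nonneg u)]
  simp [noiseForm, Matrix.mulVec_smul]
  ring

lemma map_sum_dotProduct_e (b : ℕ → Fin V.p → ℝ) (n : ℕ) :
    V.μ.map (fun ω => ∑ t ∈ Finset.range n, b t ⬝ᵥ V.e (t + 1) ω) =
      gaussianReal 0 (∑ t ∈ Finset.range n, V.noiseForm (b t)).toNNReal := by
  have hi : iIndepFun (fun t ω => b t ⬝ᵥ V.e (t + 1) ω) V.μ :=
    V.indep_e.comp (fun t (x : EuclideanSpace ℝ (Fin V.p)) => b t ⬝ᵥ x)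
      (fun t => by unfold dotProduct; fun_prop)
  induction n with
  | zero => simp [Measure.map_const]
  | succ n ih =>
    have h1 := hi.indepFun_finsetSum_of_notMem (s := Finset.range n) (i := n)
      (fun t => measurable_dotProduct_e (b t) (t + 1)) (by simp)
    have h2 := gaussianReal_add_gaussianReal_of_indepFun h1
      (by simpa [Finset.sum_fn] using ih) (map_dotProduct_e (b n) n)
    rw [Finset.sum_range_succ, Real.toNNReal_add (Finset.sum_nonneg fun _ _ => noiseForm_nonneg _)
      (noiseForm_nonneg _)]
    simpa [Finset.sum_range_succ, Finset.sum_fn, Pi.add_def] using h2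

lemma indepFun_init_sum (x : Fin V.p → ℝ) (b : ℕ → Fin V.p → ℝ) (n : ℕ) :
    IndepFun (fun ω => x ⬝ᵥ V.y 0 ω)
      (fun ω => ∑ t ∈ Finset.range n, b t ⬝ᵥ V.e (t + 1) ω) V.μ :=
  V.indep_init.comp (φ := fun z : EuclideanSpace ℝ (Fin V.p) => x ⬝ᵥ z)
    (ψ := fun z : ℕ → EuclideanSpace ℝ (Fin V.p) => ∑ t ∈ Finset.range n, b t ⬝ᵥ z t)
    (by unfold dotProduct; fun_prop) (by unfold dotProduct; fun_prop)

/-- Unrolling the recursion `N` times leaves the law of `y N`, hence of `y 0`, unchanged. -/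
lemma charFun_dotProduct_y_zero (u : Fin V.p → ℝ) (N : ℕ) (τ : ℝ) :
    charFun (V.μ.map fun ω => u ⬝ᵥ V.y 0 ω) τ =
      charFun (V.μ.map fun ω => ((V.Aᵀ ^ N) *ᵥ u) ⬝ᵥ V.y 0 ω) τ *
        Complex.exp (-((∑ k ∈ Finset.range N, V.noiseForm ((V.Aᵀ ^ k) *ᵥ u) : ℝ) * τ ^ 2 / 2)) := by
  set b : ℕ → Fin V.p → ℝ := fun t => (V.Aᵀ ^ (N - (t + 1))) *ᵥ u with hb
  have hae : (fun ω => u ⬝ᵥ V.y N ω) =ᵐ[V.μ] fun ω =>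
      ((V.Aᵀ ^ N) *ᵥ u) ⬝ᵥ V.y 0 ω + ∑ t ∈ Finset.range N, b t ⬝ᵥ V.e (t + 1) ω := by
    filter_upwards [V.ae_recursion] with ω hω
    have := sum_dotProduct_y hω (u := fun t => (V.Aᵀ ^ (N - t)) *ᵥ u) (w := fun _ => 0) (n := N)
      (fun t ht => by
        rw [add_zero, Matrix.mulVec_mulVec, ← pow_succ', show N - t = N - (t + 1) + 1 by omega])
    simpa using this
  have hsum : ∑ t ∈ Finset.range N, V.noiseForm (b t) =
      ∑ k ∈ Finset.range N, V.noiseForm ((V.Aᵀ ^ k) *ᵥ u) := by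
    rw [← Finset.sum_range_reflect]
    refine Finset.sum_congr rfl fun t ht => ?_
    rw [hb]
    have := Finset.mem_range.1 ht
    simp only
    rw [show N - (N - 1 - t + 1) = t by omega]
  rw [← map_dotProduct_y u N, Measure.map_congr hae,
    (indepFun_init_sum _ b N).charFun_map_fun_add_eq_mul
      (measurable_dotProduct_y _ 0).aemeasurable
      (Finset.measurable_sum _ fun t _ => measurable_dotProduct_e (b t) (t + 1)).aemeasurable,
    Pi.mul_apply, map_sum_dotProduct_e, charFun_gaussianReal, hsum,
    Real.coe_toNNReal _ (Finset.sum_nonneg fun _ _ => noiseForm_nonneg _)]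
  congr 2
  simp

/-- The stationary law is the centred Gaussian law with covariance `∑ Aᵏ Σ (Aᵏ)ᵀ`. -/
lemma DependenceBounds.map_dotProduct_y_zero (hV : V.DependenceBounds m M) (hm : 0 < m)
    (hM : 0 ≤ M) (u : Fin V.p → ℝ) :
    V.μ.map (fun ω => u ⬝ᵥ V.y 0 ω) = gaussianReal 0 (V.statForm u).toNNReal := by
  have := Measure.isProbabilityMeasure_map (μ := V.μ) (measurable_dotProduct_y u 0).aemeasurable
  refine Measure.ext_of_charFun ?_
  ext τ
  have h1 : Tendsto (fun N : ℕ =>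
      charFun (V.μ.map fun ω => ((V.Aᵀ ^ N) *ᵥ u) ⬝ᵥ V.y 0 ω) τ) atTop (𝓝 1) := by
    have e : ∀ N : ℕ, charFun (V.μ.map fun ω => ((V.Aᵀ ^ N) *ᵥ u) ⬝ᵥ V.y 0 ω) τ =
        ∫ ω, Complex.exp (τ * (((V.Aᵀ ^ N) *ᵥ u) ⬝ᵥ V.y 0 ω : ℝ) * Complex.I) ∂V.μ := by
      intro N
      rw [charFun_apply_real, integral_map (measurable_dotProduct_y _ 0).aemeasurable
        (by fun_prop)]
    simp only [e]
    have h := tendsto_integral_of_dominated_convergence (μ := V.μ)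
      (F := fun (N : ℕ) ω => Complex.exp (τ * (((V.Aᵀ ^ N) *ᵥ u) ⬝ᵥ V.y 0 ω : ℝ) * Complex.I))
      (f := fun _ => 1) (fun _ => 1)
      (fun N => by
        have := measurable_dotProduct_y (V := V) ((V.Aᵀ ^ N) *ᵥ u) 0
        exact Measurable.aestronglyMeasurable (by fun_prop))
      (integrable_const _)
      (fun N => ae_of_all _ fun ω => by
        rw [← Complex.ofReal_mul, Complex.norm_exp_ofReal_mul_I])
      (ae_of_all _ fun ω => by
        have hc : Continuous fun x : Fin V.p → ℝ =>
            Complex.exp (τ * (x ⬝ᵥ V.y 0 ω : ℝ) * Complex.I) := by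
          unfold dotProduct; fun_prop
        have := (hc.tendsto 0).comp (tendsto_transpose_pow_mulVec_zero V.stable u)
        simpa [Function.comp_def] using this)
    simpa using h
  have h2 : Tendsto (fun N : ℕ => Complex.exp (-((∑ k ∈ Finset.range N,
      V.noiseForm ((V.Aᵀ ^ k) *ᵥ u) : ℝ) * τ ^ 2 / 2))) atTop
      (𝓝 (Complex.exp (-((V.statForm u : ℝ) * τ ^ 2 / 2)))) := by
    have hc : Continuous fun x : ℝ => Complex.exp (-((x : ℂ) * τ ^ 2 / 2)) := by fun_prop
    exact (hc.tendsto _).comp (hV.summable_noiseForm hm hM u).hasSum.tendsto_sum_nat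
  have h3 := h1.mul h2
  simp only [← charFun_dotProduct_y_zero] at h3
  rw [tendsto_nhds_unique tendsto_const_nhds h3, charFun_gaussianReal,
    Real.coe_toNNReal _ (statForm_nonneg u)]
  simp

/-- Every linear functional of a finite piece of the trajectory and of the innovations is centred
Gaussian, and its variance is at most a multiple, depending on `m` and `M` only, of the squared
`ℓ²` norm of the coefficients. -/
lemma DependenceBounds.exists_map_eq_gaussianReal (hV : V.DependenceBounds m M) (hm : 0 < m)
    (hM : 0 ≤ M) (n : ℕ) (w b : ℕ → Fin V.p → ℝ) :
    ∃ v : NNReal, (v : ℝ) ≤ 2 * M / m * ∑ t ∈ Finset.range n, ∑ j, w t j ^ 2 +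
        2 * M * ∑ t ∈ Finset.range n, ∑ j, b t j ^ 2 ∧
      V.μ.map (fun ω => ∑ t ∈ Finset.range n, (w t ⬝ᵥ V.y t ω + b t ⬝ᵥ V.e (t + 1) ω)) =
        gaussianReal 0 v := by
  obtain ⟨x, hx1, hx2, hx3⟩ := exists_adjoint_solution hm V.stable hV.transfer_lower n w
  have hae : (fun ω => ∑ t ∈ Finset.range n, (w t ⬝ᵥ V.y t ω + b t ⬝ᵥ V.e (t + 1) ω)) =ᵐ[V.μ]
      (fun ω => x 0 ⬝ᵥ V.y 0 ω) +
        fun ω => ∑ t ∈ Finset.range n, (x (t + 1) + b t) ⬝ᵥ V.e (t + 1) ω := by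
    filter_upwards [V.ae_recursion] with ω hω
    have h := sum_dotProduct_y hω hx2
    rw [hx1, zero_dotProduct, add_zero] at h
    simp only [Pi.add_apply, Finset.sum_add_distrib, add_dotProduct, h]
    ring
  refine ⟨(V.statForm (x 0)).toNNReal +
    (∑ t ∈ Finset.range n, V.noiseForm (x (t + 1) + b t)).toNNReal, ?_, ?_⟩
  · rw [NNReal.coe_add, Real.coe_toNNReal _ (statForm_nonneg _),
      Real.coe_toNNReal _ (Finset.sum_nonneg fun _ _ => noiseForm_nonneg _)]
    set W := ∑ t ∈ Finset.range n, ∑ j, w t j ^ 2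
    set X := ∑ t ∈ Finset.range n, ∑ j, x (t + 1) j ^ 2
    have h1 : V.statForm (x 0) ≤ M * (W / m - X) := by
      refine (hV.summable_noiseForm hm hM _).tsum_le_of_sum_range_le fun N => ?_
      have h := hx3 N
      have h' : X + ∑ k ∈ Finset.range N, ∑ j, ((V.Aᵀ ^ k) *ᵥ x 0) j ^ 2 ≤ W / m := by
        rw [le_div_iff₀ hm]; linarith
      calc ∑ k ∈ Finset.range N, V.noiseForm ((V.Aᵀ ^ k) *ᵥ x 0)
          ≤ ∑ k ∈ Finset.range N, M * ∑ j, ((V.Aᵀ ^ k) *ᵥ x 0) j ^ 2 :=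
            Finset.sum_le_sum fun k _ => hV.sig_upper _
        _ = M * ∑ k ∈ Finset.range N, ∑ j, ((V.Aᵀ ^ k) *ᵥ x 0) j ^ 2 := by rw [Finset.mul_sum]
        _ ≤ _ := mul_le_mul_of_nonneg_left (by linarith) hM
    have h2 : ∑ t ∈ Finset.range n, V.noiseForm (x (t + 1) + b t) ≤
        2 * M * X + 2 * M * ∑ t ∈ Finset.range n, ∑ j, b t j ^ 2 := by
      rw [Finset.mul_sum, Finset.mul_sum, ← Finset.sum_add_distrib]
      exact Finset.sum_le_sum fun t _ => hV.noiseForm_add_le hM _ _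
    have h3 : X ≤ W / m := by
      rw [le_div_iff₀ hm]
      have := hx3 0
      simp only [Finset.range_zero, Finset.sum_empty, add_zero] at this
      linarith
    have h4 : M * X ≤ M * (W / m) := mul_le_mul_of_nonneg_left h3 hM
    have h5 : 2 * M / m * W = 2 * (M * (W / m)) := by ring
    rw [h5]
    linarith
  · rw [Measure.map_congr hae]
    have := gaussianReal_add_gaussianReal_of_indepFun
      (indepFun_init_sum (x 0) (fun t => x (t + 1) + b t) n)
      (hV.map_dotProduct_y_zero hm hM (x 0)) (map_sum_dotProduct_e (fun t => x (t + 1) + b t) n)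
    rwa [add_zero] at this

end GaussianVAR

/-! ### Entrywise concentration of the Gram matrix and of the noise correlations -/

namespace GaussianVAR

open Matrix Real

variable {V : GaussianVAR.{u}} {m M : ℝ}

/-- The entries of the stationary covariance matrix `Γ = E (y 0) (y 0)ᵀ`. -/
noncomputable def statCov (V : GaussianVAR.{u}) (j k : Fin V.p) : ℝ :=
  ∫ ω, V.y 0 ω j * V.y 0 ω k ∂V.μ

/-- A constant `K` such that, for `‖α‖² ≤ 4` and `‖β‖² ≤ 1`, the covariance of the sequence
`α ⬝ y t + β ⬝ e (t + 1)` has operator norm at most `K`. The coefficients used for polarization,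
`±` sums of two basis vectors, satisfy these bounds. -/
noncomputable def proxy (m M : ℝ) : ℝ := 8 * M / m + 2 * M

lemma DependenceBounds.memLp_dotProduct_y (hV : V.DependenceBounds m M) (hm : 0 < m)
    (hM : 0 ≤ M) (u : Fin V.p → ℝ) : MemLp (fun ω => u ⬝ᵥ V.y 0 ω) 2 V.μ := by
  have h2 : MemLp id 2 (V.μ.map (fun ω => u ⬝ᵥ V.y 0 ω)) :=
    hV.map_dotProduct_y_zero hm hM u ▸ memLp_id_gaussianReal 2
  exact (memLp_map_measure_iff (by fun_prop) (measurable_dotProduct_y u 0).aemeasurable).1 h2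

lemma DependenceBounds.memLp_y (hV : V.DependenceBounds m M) (hm : 0 < m)
    (hM : 0 ≤ M) (j : Fin V.p) : MemLp (fun ω => V.y 0 ω j) 2 V.μ := by
  simpa using hV.memLp_dotProduct_y hm hM (Pi.single j 1)

lemma integral_sq_dotProduct_y (u : Fin V.p → ℝ) (t : ℕ) :
    ∫ ω, (u ⬝ᵥ V.y t ω) ^ 2 ∂V.μ = ∫ ω, (u ⬝ᵥ V.y 0 ω) ^ 2 ∂V.μ := by
  have h : ∀ s, ∫ ω, (u ⬝ᵥ V.y s ω) ^ 2 ∂V.μ =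
      ∫ x, x ^ 2 ∂(V.μ.map fun ω => u ⬝ᵥ V.y s ω) := fun s => by
    rw [integral_map (measurable_dotProduct_y u s).aemeasurable (by fun_prop)]
  rw [h, h, map_dotProduct_y]

/-- The quadratic form of `Γ` is the variance of the functionals of the stationary law. -/
lemma DependenceBounds.sum_statCov (hV : V.DependenceBounds m M) (hm : 0 < m)
    (hM : 0 ≤ M) (v : Fin V.p → ℝ) :
    ∑ j, ∑ k, v j * v k * V.statCov j k = V.statForm v := by
  have h1 := integral_sq_of_map_eq_gaussianReal (measurable_dotProduct_y v 0).aemeasurable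
    (hV.map_dotProduct_y_zero hm hM v)
  rw [Real.coe_toNNReal _ (statForm_nonneg v)] at h1
  have hint : ∀ j k, Integrable (fun ω => V.y 0 ω j * V.y 0 ω k) V.μ := fun j k =>
    (hV.memLp_y hm hM j).integrable_mul (hV.memLp_y hm hM k)
  rw [← h1]
  have e : ∀ ω, (v ⬝ᵥ V.y 0 ω) ^ 2 = ∑ j, ∑ k, v j * v k * (V.y 0 ω j * V.y 0 ω k) := by
    intro ω
    rw [sq, dotProduct, Finset.sum_mul_sum]
    exact Finset.sum_congr rfl fun j _ => Finset.sum_congr rfl fun k _ => by ring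
  simp only [e]
  rw [integral_finsetSum _ fun j _ => integrable_finsetSum _ fun k _ => (hint j k).const_mul _]
  refine Finset.sum_congr rfl fun j _ => ?_
  rw [integral_finsetSum _ fun k _ => (hint j k).const_mul _]
  exact Finset.sum_congr rfl fun k _ => by rw [integral_const_mul]; rfl

/-- The sum of squares of `α ⬝ y t + β ⬝ e (t + 1)` over the sample concentrates. -/
lemma DependenceBounds.measureReal_sum_sq_dev_le (hV : V.DependenceBounds m M) (hm : 0 < m)
    (hM : 0 < M) (n : ℕ) {α β : Fin V.p → ℝ} (hα : ∑ j, α j ^ 2 ≤ 4) (hβ : ∑ j, β j ^ 2 ≤ 1)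
    {η : ℝ} (hη : 0 ≤ η) (hηK : η ≤ proxy m M) :
    V.μ.real {ω | n * η ≤ |∑ t : Fin n, (α ⬝ᵥ V.y t ω + β ⬝ᵥ V.e (t + 1) ω) ^ 2 -
      ∑ t : Fin n, ∫ ω', (α ⬝ᵥ V.y t ω' + β ⬝ᵥ V.e (t + 1) ω') ^ 2 ∂V.μ|} ≤
        2 * exp (-(n * η ^ 2 / (8 * proxy m M ^ 2))) := by
  refine measureReal_abs_sum_sq_sub_ge_le
    (G := fun (t : Fin n) ω => α ⬝ᵥ V.y t ω + β ⬝ᵥ V.e (t + 1) ω)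
    (fun t => (measurable_dotProduct_y _ _).add (measurable_dotProduct_e _ _))
    (by unfold proxy; positivity) (fun c => ?_) hη hηK
  set c' : ℕ → ℝ := fun t => if h : t < n then c ⟨t, h⟩ else 0 with hc'
  have hcc : ∀ t : Fin n, c' t = c t := fun t => by simp [hc']
  obtain ⟨v, hv1, hv2⟩ := hV.exists_map_eq_gaussianReal hm hM.le n (fun t => c' t • α)
    (fun t => c' t • β)
  refine ⟨v, hv1.trans ?_, ?_⟩
  · have e : ∀ x : Fin V.p → ℝ, ∑ t ∈ Finset.range n, ∑ j, (c' t • x) j ^ 2 =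
        (∑ t, c t ^ 2) * ∑ j, x j ^ 2 := by
      intro x
      rw [Finset.sum_range, Finset.sum_mul]
      refine Finset.sum_congr rfl fun t _ => ?_
      rw [Finset.mul_sum]
      exact Finset.sum_congr rfl fun j _ => by simp [hcc, mul_pow]
    rw [e, e]
    have hc0 : 0 ≤ ∑ t, c t ^ 2 := Finset.sum_nonneg fun _ _ => sq_nonneg _
    calc 2 * M / m * ((∑ t, c t ^ 2) * ∑ j, α j ^ 2) + 2 * M * ((∑ t, c t ^ 2) * ∑ j, β j ^ 2)
        ≤ 2 * M / m * ((∑ t, c t ^ 2) * 4) + 2 * M * ((∑ t, c t ^ 2) * 1) := by gcongr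
      _ = _ := by unfold proxy; ring
  · rw [← hv2]
    congr 1
    funext ω
    rw [Finset.sum_range]
    refine Finset.sum_congr rfl fun t _ => ?_
    simp only [hcc, smul_dotProduct, smul_eq_mul]
    ring

/-- Since `y t` and `e (t + 1)` are uncorrelated, the second moment of `α ⬝ y t + β ⬝ e (t + 1)`
depends on `β` only through its variance. -/
lemma DependenceBounds.exists_integral_sq_eq (hV : V.DependenceBounds m M) (hm : 0 < m)
    (hM : 0 ≤ M) (α : Fin V.p → ℝ) (t : ℕ) :
    ∃ c : ℝ, ∀ β : Fin V.p → ℝ,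
      ∫ ω, (α ⬝ᵥ V.y t ω + β ⬝ᵥ V.e (t + 1) ω) ^ 2 ∂V.μ = c + V.noiseForm β := by
  set x : ℕ → Fin V.p → ℝ := fun s => (V.Aᵀ ^ (t - s)) *ᵥ α with hx
  refine ⟨V.statForm (x 0) + ∑ s ∈ Finset.range t, V.noiseForm (x (s + 1)), fun β => ?_⟩
  set b : ℕ → Fin V.p → ℝ := fun s => if s < t then x (s + 1) else β with hb
  have hae : (fun ω => α ⬝ᵥ V.y t ω + β ⬝ᵥ V.e (t + 1) ω) =ᵐ[V.μ] (fun ω => x 0 ⬝ᵥ V.y 0 ω) +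
        fun ω => ∑ s ∈ Finset.range (t + 1), b s ⬝ᵥ V.e (s + 1) ω := by
    filter_upwards [V.ae_recursion] with ω hω
    have h := sum_dotProduct_y hω (u := x) (w := fun _ => 0) (n := t) (fun s hs => by
      rw [add_zero, hx]
      simp only
      rw [Matrix.mulVec_mulVec, ← pow_succ', show t - s = t - (s + 1) + 1 by omega])
    have h1 : x t = α := by simp [hx]
    simp only [zero_dotProduct, Finset.sum_const_zero, zero_add, h1] at h
    have h2 : ∑ s ∈ Finset.range t, b s ⬝ᵥ V.e (s + 1) ω =
        ∑ s ∈ Finset.range t, x (s + 1) ⬝ᵥ V.e (s + 1) ω :=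
      Finset.sum_congr rfl fun s hs => by simp [hb, Finset.mem_range.1 hs]
    rw [Pi.add_apply, Finset.sum_range_succ, h2, h, show b t = β by simp [hb]]
    ring
  have hlaw := gaussianReal_add_gaussianReal_of_indepFun (indepFun_init_sum (x 0) b (t + 1))
    (hV.map_dotProduct_y_zero hm hM (x 0)) (map_sum_dotProduct_e b (t + 1))
  rw [← Measure.map_congr hae, add_zero] at hlaw
  have hmeas : Measurable fun ω => α ⬝ᵥ V.y t ω + β ⬝ᵥ V.e (t + 1) ω :=
    (measurable_dotProduct_y _ _).add (measurable_dotProduct_e _ _)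
  rw [integral_sq_of_map_eq_gaussianReal hmeas.aemeasurable hlaw, NNReal.coe_add,
    Real.coe_toNNReal _ (statForm_nonneg _),
    Real.coe_toNNReal _ (Finset.sum_nonneg fun _ _ => noiseForm_nonneg _), Finset.sum_range_succ,
    show b t = β by simp [hb], add_assoc]
  congr 2
  exact Finset.sum_congr rfl fun s hs => by simp [hb, Finset.mem_range.1 hs]

lemma sum_sq_single_add_le {p : ℕ} (j k : Fin p) {s : ℝ} (hs : s ^ 2 = 1) :
    ∑ l, (Pi.single j 1 + s • Pi.single k 1 : Fin p → ℝ) l ^ 2 ≤ 4 := by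
  calc ∑ l, (Pi.single j 1 + s • Pi.single k 1 : Fin p → ℝ) l ^ 2
      ≤ ∑ l, (2 * (Pi.single j 1 : Fin p → ℝ) l + 2 * (Pi.single k 1 : Fin p → ℝ) l) := by
        refine Finset.sum_le_sum fun l _ => ?_
        simp only [Pi.add_apply, Pi.smul_apply, Pi.single_apply, smul_eq_mul]
        split_ifs <;> nlinarith [sq_nonneg (s - 1)]
    _ = 4 := by rw [Finset.sum_add_distrib, ← Finset.mul_sum, ← Finset.mul_sum]; simp; norm_num

/-- A deviation bound for a difference of two quantities from deviation bounds for each. -/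
lemma measureReal_abs_sub_gt_le {Ω : Type*} {mΩ : MeasurableSpace Ω} {P : Measure Ω}
    [IsProbabilityMeasure P] {X Y Z : Ω → ℝ} {x y z a b : ℝ}
    (hZ : ∀ ω, 4 * (Z ω - z) = (X ω - x) - (Y ω - y))
    (hX : P.real {ω | 2 * a ≤ |X ω - x|} ≤ b) (hY : P.real {ω | 2 * a ≤ |Y ω - y|} ≤ b) :
    P.real {ω | a < |Z ω - z|} ≤ 2 * b := by
  refine (measureReal_mono (s₂ := {ω | 2 * a ≤ |X ω - x|} ∪ {ω | 2 * a ≤ |Y ω - y|}) ?_).trans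
    ((measureReal_union_le _ _).trans (by linarith))
  intro ω hω
  simp only [Set.mem_union, Set.mem_ofPred_eq] at hω ⊢
  by_contra! hcon
  have h1 : |4 * (Z ω - z)| < 4 * a := by
    rw [hZ]
    exact (abs_sub _ _).trans_lt (by linarith)
  rw [abs_mul, abs_of_pos (by norm_num : (0 : ℝ) < 4)] at h1
  linarith

/-- Concentration of one entry of the Gram matrix, by polarization. -/
lemma DependenceBounds.measureReal_gram_dev_le (hV : V.DependenceBounds m M) (hm : 0 < m)
    (hM : 0 < M) (n : ℕ) (j k : Fin V.p) {η : ℝ} (hη : 0 ≤ η) (hηK : 2 * η ≤ proxy m M) :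
    V.μ.real {ω | n * η < |∑ t : Fin n, V.y t ω j * V.y t ω k - n * V.statCov j k|} ≤
        4 * exp (-(n * η ^ 2 / (2 * proxy m M ^ 2))) := by
  have key := fun s (hs : s ^ 2 = 1) => hV.measureReal_sum_sq_dev_le hm hM n (β := 0)
    (sum_sq_single_add_le j k (s := s) hs) (by simp) (by linarith : 0 ≤ 2 * η) hηK
  have h1 := key 1 (by norm_num)
  have h2 := key (-1) (by norm_num)
  rw [show n * (2 * η) = 2 * (n * η) by ring, show (n : ℝ) * (2 * η) ^ 2 / (8 * proxy m M ^ 2) =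
    n * η ^ 2 / (2 * proxy m M ^ 2) by ring] at h1 h2
  refine (measureReal_abs_sub_gt_le (fun ω => ?_) h1 h2).trans (by linarith)
  have hpol : ∀ t : ℕ,
      ∫ ω, ((Pi.single j 1 + (1 : ℝ) • Pi.single k 1 : Fin V.p → ℝ) ⬝ᵥ V.y t ω) ^ 2 ∂V.μ -
      ∫ ω, ((Pi.single j 1 + (-1 : ℝ) • Pi.single k 1 : Fin V.p → ℝ) ⬝ᵥ V.y t ω) ^ 2 ∂V.μ =
        4 * V.statCov j k := by
    intro t
    rw [integral_sq_dotProduct_y _ t, integral_sq_dotProduct_y _ t, ← integral_sub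
      (hV.memLp_dotProduct_y hm hM.le _).integrable_sq
      (hV.memLp_dotProduct_y hm hM.le _).integrable_sq, statCov, ← integral_const_mul]
    refine integral_congr_ae (ae_of_all _ fun ω => ?_)
    simp only [add_dotProduct, smul_dotProduct, single_one_dotProduct, smul_eq_mul]
    ring
  have hpol' : ∑ t : Fin n,
      ∫ ω, ((Pi.single j 1 + (1 : ℝ) • Pi.single k 1 : Fin V.p → ℝ) ⬝ᵥ V.y t ω) ^ 2 ∂V.μ -
      ∑ t : Fin n,
      ∫ ω, ((Pi.single j 1 + (-1 : ℝ) • Pi.single k 1 : Fin V.p → ℝ) ⬝ᵥ V.y t ω) ^ 2 ∂V.μ =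
        4 * (n * V.statCov j k) := by
    rw [← Finset.sum_sub_distrib, Finset.sum_congr rfl fun (t : Fin n) _ => hpol t]
    simp
    ring
  simp only [zero_dotProduct, add_zero]
  rw [mul_sub, ← hpol', Finset.mul_sum]
  have : ∑ t : Fin n, 4 * (V.y t ω j * V.y t ω k) =
      ∑ t : Fin n, ((Pi.single j 1 + (1 : ℝ) • Pi.single k 1 : Fin V.p → ℝ) ⬝ᵥ V.y t ω) ^ 2 -
      ∑ t : Fin n, ((Pi.single j 1 + (-1 : ℝ) • Pi.single k 1 : Fin V.p → ℝ) ⬝ᵥ V.y t ω) ^ 2 := by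
    rw [← Finset.sum_sub_distrib]
    refine Finset.sum_congr rfl fun t _ => ?_
    simp only [add_dotProduct, smul_dotProduct, single_one_dotProduct, smul_eq_mul]
    ring
  rw [this]
  ring

/-- Concentration of one sample correlation of the design with the noise, by polarization. -/
lemma DependenceBounds.measureReal_noise_dev_le (hV : V.DependenceBounds m M) (hm : 0 < m)
    (hM : 0 < M) (n : ℕ) (j i : Fin V.p) {η : ℝ} (hη : 0 ≤ η) (hηK : 2 * η ≤ proxy m M) :
    V.μ.real {ω | n * η < |∑ t : Fin n, V.y t ω j * V.e (t + 1) ω i|} ≤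
        4 * exp (-(n * η ^ 2 / (2 * proxy m M ^ 2))) := by
  have key := fun β (hβ : ∑ j, β j ^ 2 ≤ 1) => hV.measureReal_sum_sq_dev_le hm hM n
    (α := Pi.single j 1) (β := β) (by simp [Pi.single_apply]) hβ (by linarith : 0 ≤ 2 * η) hηK
  have h1 := key (Pi.single i 1) (by simp [Pi.single_apply])
  have h2 := key (-Pi.single i 1) (by simp [Pi.single_apply])
  rw [show n * (2 * η) = 2 * (n * η) by ring, show (n : ℝ) * (2 * η) ^ 2 / (8 * proxy m M ^ 2) =
    n * η ^ 2 / (2 * proxy m M ^ 2) by ring] at h1 h2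
  have h3 := measureReal_abs_sub_gt_le
    (Z := fun ω => ∑ t : Fin n, V.y t ω j * V.e (t + 1) ω i) (z := 0) (fun ω => ?_) h1 h2
  · simp only [sub_zero] at h3
    exact h3.trans (by linarith)
  have he : ∀ t : Fin n,
      ∫ ω', ((Pi.single j 1 : Fin V.p → ℝ) ⬝ᵥ V.y t ω' + Pi.single i 1 ⬝ᵥ V.e (t + 1) ω') ^ 2 ∂V.μ =
      ∫ ω', ((Pi.single j 1 : Fin V.p → ℝ) ⬝ᵥ V.y t ω' +
        (-Pi.single i 1) ⬝ᵥ V.e (t + 1) ω') ^ 2 ∂V.μ := by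
    intro t
    obtain ⟨c, hc⟩ := hV.exists_integral_sq_eq hm hM.le (Pi.single j 1) t
    rw [hc, hc, noiseForm_neg]
  rw [Finset.sum_congr rfl fun t _ => he t, sub_sub_sub_cancel_right, ← Finset.sum_sub_distrib,
    sub_zero, Finset.mul_sum]
  refine Finset.sum_congr rfl fun t _ => ?_
  simp only [neg_dotProduct, single_one_dotProduct]
  ring

end GaussianVAR

/-! ### The Lasso on a fixed design -/

section Lasso

open Matrix

lemma numNonzero_eq_card {p : ℕ} (v : Fin p → ℝ) :
    numNonzero v = (Finset.univ.filter fun j => v j ≠ 0).card := by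
  rw [numNonzero, Set.ncard_eq_toFinset_card']
  congr 1
  ext j
  simp

lemma sq_sum_abs_le_numNonzero_mul {p : ℕ} (v : Fin p → ℝ) :
    (∑ j, |v j|) ^ 2 ≤ numNonzero v * ∑ j, v j ^ 2 := by
  have h1 : ∑ j, |v j| = ∑ j ∈ Finset.univ.filter (fun j => v j ≠ 0), |v j| :=
    (Finset.sum_filter_of_ne fun j _ h => by simpa using h).symm
  rw [h1, numNonzero_eq_card]
  refine (sq_sum_le_card_mul_sum_sq).trans ?_
  gcongr
  simp only [sq_abs]
  exact Finset.sum_le_sum_of_subset_of_nonneg (Finset.filter_subset _ _) fun _ _ _ => sq_nonneg _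

/-- The quadratic form of the Gram matrix deviates by at most `δ ‖v‖₁²` if its entries deviate by
at most `δ`. -/
lemma abs_sum_sq_mulVec_div_sub_le {n p : ℕ} (X : Matrix (Fin n) (Fin p) ℝ)
    {C : Fin p → Fin p → ℝ} {δ : ℝ}
    (h : ∀ j k, |(∑ t, X t j * X t k) / (n : ℝ) - C j k| ≤ δ) (v : Fin p → ℝ) :
    |(∑ t, (X.mulVec v t) ^ 2) / (n : ℝ) - ∑ j, ∑ k, v j * v k * C j k| ≤
      δ * (∑ j, |v j|) ^ 2 := by
  have e1 : (∑ t, (X.mulVec v t) ^ 2) / (n : ℝ) =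
      ∑ j, ∑ k, v j * v k * ((∑ t, X t j * X t k) / (n : ℝ)) := by
    have : ∀ t, (X.mulVec v t) ^ 2 = ∑ j, ∑ k, v j * v k * (X t j * X t k) := fun t => by
      rw [sq, mulVec, dotProduct, Finset.sum_mul_sum]
      exact Finset.sum_congr rfl fun j _ => Finset.sum_congr rfl fun k _ => by ring
    simp only [this]
    rw [Finset.sum_comm, Finset.sum_div]
    refine Finset.sum_congr rfl fun j _ => ?_
    rw [Finset.sum_comm, Finset.sum_div]
    refine Finset.sum_congr rfl fun k _ => ?_
    rw [← Finset.mul_sum, mul_div_assoc]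
  rw [e1, ← Finset.sum_sub_distrib, sq, Finset.sum_mul_sum, Finset.mul_sum]
  refine (Finset.abs_sum_le_sum_abs _ _).trans (Finset.sum_le_sum fun j _ => ?_)
  rw [← Finset.sum_sub_distrib, Finset.mul_sum]
  refine (Finset.abs_sum_le_sum_abs _ _).trans (Finset.sum_le_sum fun k _ => ?_)
  rw [← mul_sub, abs_mul, abs_mul, mul_comm]
  exact mul_le_mul_of_nonneg_right (h j k) (by positivity)

lemma nonneg_of_forall_mul_add_sq_mul_nonneg {a c : ℝ}
    (h : ∀ τ : ℝ, 0 < τ → τ < 1 → 0 ≤ τ * a + τ ^ 2 * c) : 0 ≤ a := by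
  have h1 : ∀ᶠ τ in 𝓝[>] (0 : ℝ), 0 ≤ a + τ * c := by
    filter_upwards [Ioo_mem_nhdsGT (zero_lt_one' ℝ)] with τ hτ
    have h2 := h τ hτ.1 hτ.2
    rw [show τ * a + τ ^ 2 * c = τ * (a + τ * c) by ring] at h2
    exact nonneg_of_mul_nonneg_right h2 hτ.1
  have h3 : Tendsto (fun τ : ℝ => a + τ * c) (𝓝[>] 0) (𝓝 (a + 0 * c)) :=
    ((by fun_prop : Continuous fun τ : ℝ => a + τ * c).tendsto 0).mono_left nhdsWithin_le_nhds
  have h4 := ge_of_tendsto h3 h1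
  linarith

variable {n p : ℕ} {X : Matrix (Fin n) (Fin p) ℝ} {Y : Fin n → ℝ} {lam : ℝ} {α : Fin p → ℝ}

/-- The increment of the Lasso criterion in one coordinate. -/
lemma IsLasso.coordinate_nonneg (h : IsLasso X Y lam α) (j : Fin p) (τ : ℝ) :
    0 ≤ -(2 * τ * ((Xᵀ *ᵥ (Y - X *ᵥ α)) j / n)) + τ ^ 2 * ((∑ t, X t j ^ 2) / n) +
      2 * lam * (|α j + τ| - |α j|) := by
  have h1 := isMinOn_univ_iff.1 h (α + Pi.single j τ)
  have h2 : ∑ t, (Y t - X.mulVec (α + Pi.single j τ) t) ^ 2 =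
      ∑ t, (Y t - X.mulVec α t) ^ 2 - 2 * τ * (Xᵀ *ᵥ (Y - X *ᵥ α)) j +
        τ ^ 2 * ∑ t, X t j ^ 2 := by
    have e : (Xᵀ *ᵥ (Y - X *ᵥ α)) j = ∑ t, X t j * (Y t - (X *ᵥ α) t) := rfl
    rw [e, Finset.mul_sum, Finset.mul_sum, ← Finset.sum_sub_distrib, ← Finset.sum_add_distrib]
    refine Finset.sum_congr rfl fun t _ => ?_
    rw [mulVec_add, Pi.add_apply, mulVec_single]
    simp
    ring
  have h3 : ∑ l, |(α + Pi.single j τ : Fin p → ℝ) l| = ∑ l, |α l| + (|α j + τ| - |α j|) := by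
    have hsplit : ∀ f : Fin p → ℝ, ∑ l, |f l| = |f j| + ∑ l ∈ Finset.univ.erase j, |f l| :=
      fun f => (Finset.add_sum_erase Finset.univ (fun l => |f l|) (Finset.mem_univ j)).symm
    rw [hsplit, hsplit α]
    have : ∑ l ∈ Finset.univ.erase j, |(α + Pi.single j τ : Fin p → ℝ) l| =
        ∑ l ∈ Finset.univ.erase j, |α l| :=
      Finset.sum_congr rfl fun l hl => by simp [Finset.ne_of_mem_erase hl]
    rw [this]
    simp
    ring
  rw [h2, h3] at h1
  rw [add_div, sub_div, mul_div_assoc, mul_div_assoc (τ ^ 2)] at h1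
  linarith

/-- First Karush–Kuhn–Tucker condition. -/
lemma IsLasso.abs_grad_le (h : IsLasso X Y lam α) (hlam : 0 ≤ lam) (j : Fin p) :
    |(Xᵀ *ᵥ (Y - X *ᵥ α)) j / n| ≤ lam := by
  set g := (Xᵀ *ᵥ (Y - X *ᵥ α)) j / n
  set c := (∑ t, X t j ^ 2) / n
  have h1 : ∀ τ : ℝ, 0 ≤ -(2 * τ * g) + τ ^ 2 * c + 2 * lam * |τ| := by
    intro τ
    have h2 := h.coordinate_nonneg j τ
    have h3 : |α j + τ| - |α j| ≤ |τ| := by linarith [abs_add_le (α j) τ]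
    nlinarith [mul_le_mul_of_nonneg_left h3 hlam]
  rw [abs_le]
  constructor
  · have := nonneg_of_forall_mul_add_sq_mul_nonneg (a := 2 * (g + lam)) (c := c) fun τ h0 _ => by
      have := h1 (-τ)
      rw [abs_neg, abs_of_pos h0] at this
      linarith
    linarith
  · have := nonneg_of_forall_mul_add_sq_mul_nonneg (a := 2 * (lam - g)) (c := c) fun τ h0 _ => by
      have := h1 τ
      rw [abs_of_pos h0] at this
      linarith
    linarith

/-- Second Karush–Kuhn–Tucker condition: the gradient is `lam` times the sign on the support. It
follows by rescaling a single coordinate. -/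
lemma IsLasso.mul_grad_eq (h : IsLasso X Y lam α) (j : Fin p) :
    α j * ((Xᵀ *ᵥ (Y - X *ᵥ α)) j / n) = lam * |α j| := by
  set g := (Xᵀ *ᵥ (Y - X *ᵥ α)) j / n
  set c := (∑ t, X t j ^ 2) / n
  have h1 : ∀ σ : ℝ, |σ| < 1 →
      0 ≤ σ * (2 * (lam * |α j| - α j * g)) + σ ^ 2 * (α j ^ 2 * c) := by
    intro σ hσ
    have h2 := h.coordinate_nonneg j (σ * α j)
    have h3 : |α j + σ * α j| = (1 + σ) * |α j| := by
      rw [show α j + σ * α j = (1 + σ) * α j by ring, abs_mul, abs_of_pos]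
      linarith [(abs_lt.1 hσ).1]
    rw [h3] at h2
    linarith
  refine le_antisymm ?_ ?_
  · have := nonneg_of_forall_mul_add_sq_mul_nonneg (a := 2 * (lam * |α j| - α j * g))
      (c := α j ^ 2 * c) fun τ h0 h2 => h1 τ (by rwa [abs_of_pos h0])
    linarith
  · have := nonneg_of_forall_mul_add_sq_mul_nonneg (a := -(2 * (lam * |α j| - α j * g)))
      (c := α j ^ 2 * c) fun τ h0 h2 => by
        have := h1 (-τ) (by rwa [abs_neg, abs_of_pos h0])
        linarith
    linarith

/-- The number of variables selected by the Lasso is at most a multiple of the sparsity of the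
target `a`, provided that the noise level is at most `lam / 4`, the Gram matrix is bounded below
by `κ` up to `δ ‖v‖₁²` (which on the cone of the estimation error is negligible), and it is
bounded above on sparse vectors. -/
lemma IsLasso.numNonzero_le (hα : IsLasso X Y lam α) (hn : 0 < n) (hlam : 0 < lam)
    {a : Fin p → ℝ} {ε : Fin n → ℝ} (hY : Y = X *ᵥ a + ε)
    (hε : ∀ j, |(Xᵀ *ᵥ ε) j / n| ≤ lam / 4)
    {κ δ cUp : ℝ} (hκ : 0 < κ) (hδ : 0 ≤ δ) (hcUp : 0 < cUp)
    (hlow : ∀ v : Fin p → ℝ,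
      κ * ∑ j, v j ^ 2 ≤ (∑ t, (X.mulVec v t) ^ 2) / (n : ℝ) + δ * (∑ j, |v j|) ^ 2)
    (hδκ : 9 * numNonzero a * δ ≤ κ / 2) {sR : ℕ}
    (hup : ∀ v : Fin p → ℝ, numNonzero v ≤ sR →
      (∑ t, (X.mulVec v t) ^ 2) / (n : ℝ) ≤ cUp * ∑ j, v j ^ 2)
    (hsR : 6 * cUp / κ * numNonzero a < sR) :
    (numNonzero α : ℝ) ≤ 6 * cUp / κ * numNonzero a := by
  have hn0 : (0 : ℝ) < n := by exact_mod_cast hn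
  set S := Finset.univ.filter fun j => a j ≠ 0 with hS
  have hs : (numNonzero a : ℝ) = S.card := by rw [numNonzero_eq_card]
  rw [hs] at hδκ hsR ⊢
  set h : Fin p → ℝ := α - a with hh
  set g : Fin p → ℝ := fun j => (Xᵀ *ᵥ (Y - X *ᵥ α)) j / n with hg
  set G : Fin p → ℝ := fun j => (Xᵀ *ᵥ (X *ᵥ h)) j / n with hG
  have hGg : ∀ j, G j = (Xᵀ *ᵥ ε) j / n - g j := by
    intro j
    have : X *ᵥ h = ε - (Y - X *ᵥ α) := by
      rw [hY, hh, mulVec_sub]; abel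
    simp only [hG, hg]
    rw [this, mulVec_sub, Pi.sub_apply, sub_div]
  have hadj : ∀ v : Fin p → ℝ, ∑ j, v j * G j = (∑ t, (X *ᵥ v) t * (X *ᵥ h) t) / n := by
    intro v
    have : v ⬝ᵥ (Xᵀ *ᵥ (X *ᵥ h)) = (X *ᵥ v) ⬝ᵥ (X *ᵥ h) := by
      rw [dotProduct_mulVec, vecMul_transpose]
    simp only [dotProduct] at this
    rw [← this, Finset.sum_div]
    exact Finset.sum_congr rfl fun j _ => by simp only [hG]; ring
  set D : ℝ := (∑ t, ((X *ᵥ h) t) ^ 2) / n with hD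
  have hD0 : 0 ≤ D := div_nonneg (Finset.sum_nonneg fun _ _ => sq_nonneg _) hn0.le
  have hDG : D = ∑ j, h j * G j := by
    rw [hadj, hD]; simp only [sq]
  -- the basic inequality
  have hbasic : D ≤ 5 / 4 * lam * ∑ j ∈ S, |h j| - 3 / 4 * lam * ∑ j ∈ Sᶜ, |h j| := by
    rw [hDG, ← Finset.sum_add_sum_compl S, Finset.mul_sum, Finset.mul_sum, sub_eq_add_neg,
      ← Finset.sum_neg_distrib]
    refine add_le_add (Finset.sum_le_sum fun j _ => ?_) (Finset.sum_le_sum fun j hj => ?_)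
    · have h1 := hα.abs_grad_le hlam.le j
      have h2 : |G j| ≤ 5 / 4 * lam := by
        rw [hGg]
        exact (abs_sub _ _).trans (by linarith [hε j])
      calc h j * G j ≤ |h j| * |G j| := by rw [← abs_mul]; exact le_abs_self _
        _ ≤ |h j| * (5 / 4 * lam) := by gcongr
        _ = _ := by ring
    · have haj : a j = 0 := by simpa [hS] using hj
      have hhj : h j = α j := by simp [hh, haj]
      have h1 := hα.mul_grad_eq j
      have h2 : α j * ((Xᵀ *ᵥ ε) j / n) ≤ |α j| * (lam / 4) := by
        refine (le_abs_self _).trans ?_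
        rw [abs_mul]
        exact mul_le_mul_of_nonneg_left (hε j) (abs_nonneg _)
      rw [hGg, hhj, mul_sub]
      simp only [hg]
      rw [h1]
      linarith
  set HS := ∑ j ∈ S, |h j| with hHS
  have hHS0 : 0 ≤ HS := Finset.sum_nonneg fun _ _ => abs_nonneg _
  set N2 := ∑ j, h j ^ 2 with hN2
  have hN20 : 0 ≤ N2 := Finset.sum_nonneg fun _ _ => sq_nonneg _
  have hHSsq : HS ^ 2 ≤ S.card * N2 := by
    refine (sq_sum_le_card_mul_sum_sq).trans ?_
    simp only [sq_abs]
    gcongr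
    exact Finset.sum_le_sum_of_subset_of_nonneg (Finset.subset_univ _) fun _ _ _ => sq_nonneg _
  have hcone : ∑ j, |h j| ≤ 3 * HS := by
    rw [← Finset.sum_add_sum_compl S]
    have h1 : lam * (3 / 4 * ∑ j ∈ Sᶜ, |h j|) ≤ lam * (5 / 4 * HS) := by linarith
    have h2 := le_of_mul_le_mul_left h1 hlam
    linarith
  have hD1 : D ≤ 5 / 4 * lam * HS := by
    have : 0 ≤ 3 / 4 * lam * ∑ j ∈ Sᶜ, |h j| :=
      mul_nonneg (by linarith) (Finset.sum_nonneg fun _ _ => abs_nonneg _)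
    linarith
  -- restricted eigenvalue bound for the error
  have hRE : κ / 2 * N2 ≤ D := by
    have h1 := hlow h
    have h2 : (∑ j, |h j|) ^ 2 ≤ (3 * HS) ^ 2 :=
      pow_le_pow_left₀ (Finset.sum_nonneg fun _ _ => abs_nonneg _) hcone 2
    have h3 : δ * (∑ j, |h j|) ^ 2 ≤ κ / 2 * N2 := by
      calc δ * (∑ j, |h j|) ^ 2 ≤ δ * (9 * (S.card * N2)) := by
            gcongr
            nlinarith
        _ = 9 * S.card * δ * N2 := by ring
        _ ≤ _ := by gcongr
    linarith
  have hDle : D ≤ 25 / 8 * lam ^ 2 * S.card / κ := by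
    rw [le_div_iff₀ hκ]
    rcases hD0.eq_or_lt with h0 | h0
    · rw [← h0, zero_mul]; positivity
    · have h1 : D ^ 2 ≤ (5 / 4 * lam * HS) ^ 2 := pow_le_pow_left₀ hD0 hD1 2
      have h2 : D * (D * κ) ≤ D * (25 / 8 * lam ^ 2 * S.card) := by
        calc D * (D * κ) = D ^ 2 * κ := by ring
          _ ≤ (5 / 4 * lam * HS) ^ 2 * κ := by gcongr
          _ = 25 / 16 * lam ^ 2 * κ * HS ^ 2 := by ring
          _ ≤ 25 / 16 * lam ^ 2 * κ * (S.card * N2) := by gcongr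
          _ = 25 / 8 * lam ^ 2 * S.card * (κ / 2 * N2) := by ring
          _ ≤ 25 / 8 * lam ^ 2 * S.card * D := by gcongr
          _ = _ := by ring
      exact le_of_mul_le_mul_left h2 h0
  -- every selected variable has a correlation of at least `3 lam / 4` with the fit `X h`
  have hcount : ∀ T : Finset (Fin p), (∀ j ∈ T, α j ≠ 0) → T.card ≤ sR →
      (T.card : ℝ) ≤ 6 * cUp / κ * S.card := by
    intro T hT hTs
    set v : Fin p → ℝ := fun j => if j ∈ T then G j else 0 with hv
    have hv2 : ∑ j, v j ^ 2 = ∑ j, v j * G j :=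
      Finset.sum_congr rfl fun j _ => by simp only [hv]; split_ifs <;> ring
    have hvT : ∑ j, v j ^ 2 = ∑ j ∈ T, G j ^ 2 := by
      simp [hv, ite_pow]
    have hvn : numNonzero v ≤ sR := by
      rw [numNonzero_eq_card]
      refine (Finset.card_le_card fun j hj => ?_).trans hTs
      by_contra hjT
      simp [hv, hjT] at hj
    set Q := ∑ j, v j ^ 2 with hQ
    have hQ0 : 0 ≤ Q := Finset.sum_nonneg fun _ _ => sq_nonneg _
    have hcs : Q ^ 2 ≤ (cUp * Q) * D := by
      have h1 := Finset.sum_mul_sq_le_sq_mul_sq Finset.univ (X *ᵥ v) (X *ᵥ h)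
      have h2 : Q = (∑ t, (X *ᵥ v) t * (X *ᵥ h) t) / n := by rw [hv2, hadj]
      calc Q ^ 2 = (∑ t, (X *ᵥ v) t * (X *ᵥ h) t) ^ 2 / n ^ 2 := by rw [h2, div_pow]
        _ ≤ ((∑ t, (X *ᵥ v) t ^ 2) * ∑ t, (X *ᵥ h) t ^ 2) / n ^ 2 := by gcongr
        _ = ((∑ t, (X *ᵥ v) t ^ 2) / n) * D := by rw [hD]; field_simp
        _ ≤ _ := by gcongr; exact hup v hvn
    have hQD : Q ≤ cUp * D := by
      rcases hQ0.eq_or_lt with h0 | h0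
      · rw [← h0]; positivity
      · refine le_of_mul_le_mul_left ?_ h0
        calc Q * Q = Q ^ 2 := (sq Q).symm
          _ ≤ _ := hcs
          _ = _ := by ring
    have hQT : T.card * (9 / 16 * lam ^ 2) ≤ Q := by
      rw [hvT, ← nsmul_eq_mul]
      refine Finset.card_nsmul_le_sum _ _ _ fun j hj => ?_
      have h1 : lam = |g j| := by
        have h2 := congrArg abs (hα.mul_grad_eq j)
        rw [abs_mul, abs_mul, abs_abs, abs_of_pos hlam, mul_comm] at h2
        exact (mul_right_cancel₀ (abs_pos.2 (hT j hj)).ne' h2).symm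
      have h2 : 3 / 4 * lam ≤ |G j| := by
        rw [hGg, abs_sub_comm]
        have := abs_sub_abs_le_abs_sub (g j) ((Xᵀ *ᵥ ε) j / n)
        linarith [hε j]
      calc 9 / 16 * lam ^ 2 = (3 / 4 * lam) ^ 2 := by ring
        _ ≤ |G j| ^ 2 := pow_le_pow_left₀ (by linarith) h2 2
        _ = G j ^ 2 := sq_abs _
    have h1 : T.card * (9 / 16 * lam ^ 2) ≤ cUp * (25 / 8 * lam ^ 2 * S.card / κ) :=
      hQT.trans (hQD.trans (by gcongr))
    have h2 : lam ^ 2 * T.card ≤ lam ^ 2 * (50 / 9 * (cUp / κ * S.card)) := by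
      have e : cUp * (25 / 8 * lam ^ 2 * S.card / κ) =
        9 / 16 * (lam ^ 2 * (50 / 9 * (cUp / κ * S.card))) := by ring
      rw [e] at h1
      linarith
    have h3 := le_of_mul_le_mul_left h2 (by positivity)
    have h4 : 0 ≤ cUp / κ * S.card := by positivity
    calc (T.card : ℝ) ≤ 50 / 9 * (cUp / κ * S.card) := h3
      _ ≤ 6 * (cUp / κ * S.card) := by linarith
      _ = _ := by ring
  rw [numNonzero_eq_card]
  set A := Finset.univ.filter fun j => α j ≠ 0 with hA
  have hAne : ∀ T ⊆ A, ∀ j ∈ T, α j ≠ 0 := fun T hT j hj => (Finset.mem_filter.1 (hT hj)).2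
  rcases le_total A.card sR with hle | hle
  · exact hcount A (hAne A subset_rfl) hle
  · -- otherwise `sR` of the selected variables would contradict the count
    obtain ⟨T, hTA, hTc⟩ := Finset.exists_subset_card_eq hle
    have := hcount T (hAne T hTA) hTc.le
    rw [hTc] at this
    linarith

end Lasso

/-! ### Uniform deviations along a sparse sequence of models -/

section Asymptotics

open Matrix

variable {V : ℕ → GaussianVAR.{u}} {i : ∀ n, Fin (V n).p} {m M : ℝ}

lemma HoldsWHP.mono {E F : ∀ n, Set (V n).Ω} (hE : HoldsWHP V E)
    (h : ∀ᶠ n in atTop, E n ⊆ F n) : HoldsWHP V F :=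
  tendsto_of_tendsto_of_tendsto_of_le_of_le' tendsto_const_nhds hE
    (Eventually.of_forall fun _ => zero_le)
    (h.mono fun _ hn => measure_mono (Set.compl_subset_compl.2 hn))

/-- A union bound over at most `p ^ 2` events. -/
lemma holdsWHP_of_card_le_sq (hdim : Tendsto (fun n => (V n).p) atTop atTop)
    {ι : ℕ → Type} [∀ n, Fintype (ι n)] (hι : ∀ n, Fintype.card (ι n) ≤ (V n).p ^ 2)
    (bad : ∀ n, ι n → Set (V n).Ω)
    (hbad : ∀ᶠ n in atTop, ∀ x, (V n).μ.real (bad n x) ≤ 4 * Real.exp (-(8 * Real.log (V n).p))) :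
    HoldsWHP V fun n => {ω | ∀ x, ω ∉ bad n x} := by
  have hlim : Tendsto (fun n => ENNReal.ofReal (4 * ((V n).p : ℝ)⁻¹)) atTop (𝓝 0) := by
    have h1 : Tendsto (fun n => 4 * ((V n).p : ℝ)⁻¹) atTop (𝓝 (4 * 0)) :=
      (tendsto_inv_atTop_zero.comp (tendsto_natCast_atTop_atTop.comp hdim)).const_mul 4
    rw [mul_zero] at h1
    simpa using ENNReal.tendsto_ofReal h1
  refine tendsto_of_tendsto_of_tendsto_of_le_of_le' tendsto_const_nhds hlim
    (Eventually.of_forall fun _ => zero_le) ?_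
  filter_upwards [hbad, hdim.eventually_ge_atTop 1] with n hn hp
  have hp1 : (1 : ℝ) ≤ (V n).p := by exact_mod_cast hp
  have hexp : Real.exp (-(8 * Real.log (V n).p)) = (((V n).p : ℝ) ^ 8)⁻¹ := by
    rw [Real.exp_neg, ← Nat.cast_ofNat, Real.exp_nat_mul, Real.exp_log (by linarith)]
  have hsub : {ω | ∀ x, ω ∉ bad n x}ᶜ = ⋃ x, bad n x := by
    ext ω; simp
  rw [hsub]
  refine (measure_iUnion_fintype_le _ _).trans ?_
  calc ∑ x, (V n).μ (bad n x)
      ≤ ∑ _x : ι n, ENNReal.ofReal (4 * (((V n).p : ℝ) ^ 8)⁻¹) := by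
        refine Finset.sum_le_sum fun x _ => ?_
        rw [← hexp, ← ofReal_measureReal]
        exact ENNReal.ofReal_le_ofReal (hn x)
    _ = ENNReal.ofReal (Fintype.card (ι n) * (4 * (((V n).p : ℝ) ^ 8)⁻¹)) := by
        rw [Finset.sum_const, Finset.card_univ, nsmul_eq_mul,
          ENNReal.ofReal_mul (p := (Fintype.card (ι n) : ℝ)) (by positivity),
          ENNReal.ofReal_natCast]
    _ ≤ _ := by
        refine ENNReal.ofReal_le_ofReal ?_
        have h1 : (Fintype.card (ι n) : ℝ) ≤ ((V n).p : ℝ) ^ 2 := by exact_mod_cast hι n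
        calc (Fintype.card (ι n) : ℝ) * (4 * (((V n).p : ℝ) ^ 8)⁻¹)
            ≤ ((V n).p : ℝ) ^ 2 * (4 * (((V n).p : ℝ) ^ 8)⁻¹) := by gcongr
          _ = 4 * (((V n).p : ℝ) ^ 6)⁻¹ := by field_simp
          _ ≤ 4 * ((V n).p : ℝ)⁻¹ := by
              gcongr
              exact le_self_pow₀ hp1 (by norm_num)

/-- The entrywise rate of estimation of the covariances. -/
noncomputable def rate (V : ℕ → GaussianVAR.{u}) (m M : ℝ) (n : ℕ) : ℝ :=
  4 * GaussianVAR.proxy m M * √(Real.log (V n).p / (n : ℝ))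

/-- The event that every entry of the Gram matrix is within `rate` of the covariance. -/
def gramEvent (V : ℕ → GaussianVAR.{u}) (m M : ℝ) (n : ℕ) : Set (V n).Ω :=
  {ω | ∀ j k, |(∑ t, (V n).design n ω t j * (V n).design n ω t k) / (n : ℝ) - (V n).statCov j k| ≤
    rate V m M n}

lemma proxy_pos (hm : 0 < m) (hM : 0 < M) : 0 < GaussianVAR.proxy m M := by
  unfold GaussianVAR.proxy; positivity

lemma SparseRegime.pos (h : SparseRegime V i m M) (hm : 0 < m) : 0 < M :=
  hm.trans_le ((h.bounds 0).le (i 0))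

lemma SparseRegime.tendsto_sqrt (h : SparseRegime V i m M) :
    Tendsto (fun n => √(Real.log (V n).p / (n : ℝ))) atTop (𝓝 0) := by
  simpa using h.log_dim.sqrt

lemma SparseRegime.eventually_log (h : SparseRegime V i m M) :
    ∀ᶠ n in atTop, 0 < n ∧ 1 ≤ Real.log (V n).p :=
  (eventually_gt_atTop 0).and ((Real.tendsto_log_atTop.comp
    (tendsto_natCast_atTop_atTop.comp h.dim)).eventually_ge_atTop 1)

/-- Because `s log p / √n → 0`, the entrywise rate `√(log p / n)` is negligible even after
multiplication by the sparsity. -/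
lemma SparseRegime.tendsto_max_mul_sqrt (h : SparseRegime V i m M) :
    Tendsto (fun n => max 1 (rowSparsity V i n : ℝ) * √(Real.log (V n).p / (n : ℝ)))
      atTop (𝓝 0) := by
  have h1 := h.tendsto_sqrt.add h.sparse
  rw [add_zero] at h1
  refine tendsto_of_tendsto_of_tendsto_of_le_of_le' tendsto_const_nhds h1
    (Eventually.of_forall fun _ => by positivity) ?_
  filter_upwards [h.eventually_log] with n hn
  have hs : (0 : ℝ) ≤ rowSparsity V i n := Nat.cast_nonneg _
  have h2 : √(Real.log (V n).p / (n : ℝ)) ≤ Real.log (V n).p / √(n : ℝ) := by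
    rw [Real.sqrt_div' _ (Nat.cast_nonneg n)]
    gcongr
    rw [Real.sqrt_le_left (by linarith)]
    nlinarith
  calc max 1 (rowSparsity V i n : ℝ) * √(Real.log (V n).p / (n : ℝ))
      ≤ (1 + rowSparsity V i n) * √(Real.log (V n).p / (n : ℝ)) := by
        gcongr
        exact max_le (by linarith) (by linarith)
    _ = √(Real.log (V n).p / (n : ℝ)) + rowSparsity V i n * √(Real.log (V n).p / (n : ℝ)) := by
        ring
    _ ≤ √(Real.log (V n).p / (n : ℝ)) + rowSparsity V i n * (Real.log (V n).p / √(n : ℝ)) := by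
        gcongr
    _ = _ := by rw [mul_div_assoc]

lemma SparseRegime.eventually_rate_le (h : SparseRegime V i m M) (c : ℝ) {η : ℝ} (hη : 0 < η) :
    ∀ᶠ n in atTop, c * max 1 (rowSparsity V i n : ℝ) * rate V m M n ≤ η := by
  have h1 := h.tendsto_max_mul_sqrt.const_mul (c * (4 * GaussianVAR.proxy m M))
  rw [mul_zero] at h1
  filter_upwards [h1.eventually_le_const hη] with n hn
  refine le_trans (le_of_eq ?_) hn
  unfold rate
  ring

/-- The deviation level `rate` satisfies the hypotheses of the entrywise concentration bounds, and
turns them into `p ^ (-8)`. -/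
lemma SparseRegime.eventually_level (h : SparseRegime V i m M) (hm : 0 < m) :
    ∀ᶠ n in atTop, 0 ≤ rate V m M n ∧ 2 * rate V m M n ≤ GaussianVAR.proxy m M ∧
      n * rate V m M n ^ 2 / (2 * GaussianVAR.proxy m M ^ 2) = 8 * Real.log (V n).p ∧
      (0 : ℝ) < n := by
  have hK := proxy_pos hm (h.pos hm)
  have h1 : ∀ᶠ n in atTop, √(Real.log (V n).p / (n : ℝ)) ≤ 1 / 8 :=
    h.tendsto_sqrt.eventually_le_const (by norm_num)
  filter_upwards [h.eventually_log, h1] with n hn hn8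
  have hn0 : (0 : ℝ) < n := by exact_mod_cast hn.1
  refine ⟨by unfold rate; positivity, ?_, ?_, hn0⟩
  · unfold rate
    nlinarith
  · unfold rate
    rw [mul_pow, Real.sq_sqrt (div_nonneg (by linarith [hn.2]) hn0.le)]
    field_simp
    ring

lemma SparseRegime.holdsWHP_gramEvent (h : SparseRegime V i m M) (hm : 0 < m) :
    HoldsWHP V (gramEvent V m M) := by
  have h1 := holdsWHP_of_card_le_sq h.dim (ι := fun n => Fin (V n).p × Fin (V n).p)
    (fun n => by simp [sq])
    (fun n x => {ω | n * rate V m M n <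
      |∑ t : Fin n, (V n).y t ω x.1 * (V n).y t ω x.2 - n * (V n).statCov x.1 x.2|}) (by
      filter_upwards [h.eventually_level hm] with n hn x
      have := (h.bounds n).measureReal_gram_dev_le hm (h.pos hm) n x.1 x.2 hn.1 hn.2.1
      rwa [hn.2.2.1] at this)
  refine h1.mono ?_
  filter_upwards [h.eventually_level hm] with n hn ω hω j k
  have h2 := hω (j, k)
  simp only [not_lt] at h2
  have hn0 := hn.2.2.2
  have e : (∑ t, (V n).design n ω t j * (V n).design n ω t k) / (n : ℝ) - (V n).statCov j k =
      (∑ t : Fin n, (V n).y t ω j * (V n).y t ω k - n * (V n).statCov j k) / n := by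
    rw [sub_div, mul_div_cancel_left₀ _ hn0.ne']
    rfl
  rw [e, abs_div, abs_of_pos hn0, div_le_iff₀ hn0]
  linarith

lemma SparseRegime.isDeviationConstant (h : SparseRegime V i m M) (hm : 0 < m) :
    IsDeviationConstant V i (4 * GaussianVAR.proxy m M) := by
  have h1 := holdsWHP_of_card_le_sq h.dim (ι := fun n => Fin (V n).p)
    (fun n => by simpa using Nat.le_self_pow two_ne_zero _)
    (fun n j => {ω | n * rate V m M n <
      |∑ t : Fin n, (V n).y t ω j * (V n).e (t + 1) ω (i n)|}) (by
      filter_upwards [h.eventually_level hm] with n hn j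
      have := (h.bounds n).measureReal_noise_dev_le hm (h.pos hm) n j (i n) hn.1 hn.2.1
      rwa [hn.2.2.1] at this)
  refine h1.mono ?_
  filter_upwards [h.eventually_level hm] with n hn ω hω j
  have h2 := hω j
  simp only [not_lt] at h2
  have hn0 := hn.2.2.2
  rw [abs_div, abs_of_pos hn0, div_le_iff₀ hn0]
  refine le_trans (le_of_eq ?_) (h2.trans (le_of_eq (mul_comm _ _)))
  rfl

/-- On `gramEvent`, the quadratic form of the Gram matrix is close to that of the covariance. -/
lemma SparseRegime.abs_gram_sub_le {n : ℕ} (h : SparseRegime V i m M) (hm : 0 < m) {ω : (V n).Ω}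
    (hω : ω ∈ gramEvent V m M n) (v : Fin (V n).p → ℝ) :
    |(∑ t, (((V n).design n ω).mulVec v t) ^ 2) / (n : ℝ) - (V n).statForm v| ≤
      rate V m M n * (∑ j, |v j|) ^ 2 := by
  have := abs_sum_sq_mulVec_div_sub_le ((V n).design n ω) hω v
  rwa [(h.bounds n).sum_statCov hm (h.pos hm).le] at this

lemma SparseRegime.isSparseRiesz (h : SparseRegime V i m M) (hm : 0 < m) :
    IsSparseRiesz V i (m / 2) (M / m + m) := by
  intro sR _ hO
  obtain ⟨c, hc⟩ := hO.bound
  refine (h.holdsWHP_gramEvent hm).mono ?_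
  filter_upwards [hc, h.eventually_rate_le c (half_pos hm), h.eventually_level hm]
    with n hcn hr hn ω hω v hv
  have hM := h.pos hm
  have h1 := abs_le.1 (h.abs_gram_sub_le hm hω v)
  have hQ : 0 ≤ ∑ j, v j ^ 2 := Finset.sum_nonneg fun _ _ => sq_nonneg _
  have h2 : rate V m M n * (∑ j, |v j|) ^ 2 ≤ m / 2 * ∑ j, v j ^ 2 := by
    have h3 : (sR n : ℝ) ≤ c * max 1 (rowSparsity V i n : ℝ) := by
      rw [Real.norm_of_nonneg (Nat.cast_nonneg _), Real.norm_of_nonneg (by positivity)] at hcn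
      exact hcn
    have h4 : (numNonzero v : ℝ) ≤ sR n := by exact_mod_cast hv
    calc rate V m M n * (∑ j, |v j|) ^ 2
        ≤ rate V m M n * (numNonzero v * ∑ j, v j ^ 2) :=
          mul_le_mul_of_nonneg_left (sq_sum_abs_le_numNonzero_mul v) hn.1
      _ = numNonzero v * rate V m M n * ∑ j, v j ^ 2 := by ring
      _ ≤ c * max 1 (rowSparsity V i n : ℝ) * rate V m M n * ∑ j, v j ^ 2 := by
          refine mul_le_mul_of_nonneg_right ?_ hQ
          exact mul_le_mul_of_nonneg_right (h4.trans h3) hn.1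
      _ ≤ _ := mul_le_mul_of_nonneg_right hr hQ
  have hlo := (h.bounds n).le_statForm hm hM.le v
  have hup := (h.bounds n).statForm_le hm hM.le v
  have hmQ : 0 ≤ m / 2 * ∑ j, v j ^ 2 := by positivity
  constructor <;> linarith

/-- A union bound: if `B` does not meet `E₁ ∩ E₂ ∩ E₃` up to a null set, then its measure is at
most the sum of the measures of the complements. No measurability is needed. -/
lemma measure_le_add_measure_compl {Ω : Type*} {mΩ : MeasurableSpace Ω} {μ : Measure Ω}
    {B E₁ E₂ E₃ : Set Ω} (h : ∀ᵐ ω ∂μ, ω ∈ E₁ → ω ∈ E₂ → ω ∈ E₃ → ω ∉ B) :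
    μ B ≤ μ E₁ᶜ + μ E₂ᶜ + μ E₃ᶜ := by
  have h1 : B ⊆ ((E₁ᶜ ∪ E₂ᶜ) ∪ E₃ᶜ) ∪ {ω | ¬ (ω ∈ E₁ → ω ∈ E₂ → ω ∈ E₃ → ω ∉ B)} := by
    intro ω hω
    by_cases h1 : ω ∈ E₁ <;> by_cases h2 : ω ∈ E₂ <;> by_cases h3 : ω ∈ E₃ <;> simp [*]
  calc μ B ≤ μ ((E₁ᶜ ∪ E₂ᶜ) ∪ E₃ᶜ) + μ {ω | ¬ (ω ∈ E₁ → ω ∈ E₂ → ω ∈ E₃ → ω ∉ B)} :=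
        (measure_mono h1).trans (measure_union_le _ _)
    _ = μ ((E₁ᶜ ∪ E₂ᶜ) ∪ E₃ᶜ) := by rw [ae_iff.1 h, add_zero]
    _ ≤ μ (E₁ᶜ ∪ E₂ᶜ) + μ E₃ᶜ := measure_union_le _ _
    _ ≤ _ := by gcongr; exact measure_union_le _ _

/-- The sparsity of the Lasso: on the intersection of the noise event, the Gram event and the
sparse Riesz event, `IsLasso.numNonzero_le` applies. -/
lemma SparseRegime.isBigOInProb_numNonzero (h : SparseRegime V i m M) (hm : 0 < m)
    {C₁ cLo cUp : ℝ} (hC₁ : 0 < C₁) (hcLo : 0 < cLo) (hcUp : cLo < cUp)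
    (hD : IsDeviationConstant V i C₁) (hR : IsSparseRiesz V i cLo cUp) {lam : ℕ → ℝ}
    (hlam : ∀ n, 4 * C₁ * cUp / cLo * √(Real.log (V n).p / (n : ℝ)) ≤ lam n)
    {aHat : ∀ n, (V n).Ω → Fin (V n).p → ℝ}
    (haHat : ∀ n, ∀ᵐ ω ∂(V n).μ,
      IsLasso ((V n).design n ω) ((V n).response (i n) n ω) (lam n) (aHat n ω)) :
    IsBigOInProb V (fun n ω => (numNonzero (aHat n ω) : ℝ)) (fun n => (rowSparsity V i n : ℝ)) := by
  intro ε hε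
  refine ⟨6 * cUp / m, ?_⟩
  have hcUp0 : 0 < cUp := hcLo.trans hcUp
  -- the sparsity level has to exceed the bound `6 cUp / m * s` on the number of selected variables
  set N : ℕ := ⌈2 + 2 * cUp / cLo + 6 * cUp / m⌉₊ with hN
  have hNle : 2 + 2 * cUp / cLo + 6 * cUp / m ≤ (N : ℝ) := Nat.le_ceil _
  set sR : ℕ → ℕ := fun n => N * rowSparsity V i n + 2 with hsR
  have hsRc : ∀ n, (sR n : ℝ) = N * rowSparsity V i n + 2 := fun n => by simp [hsR]
  have hs0 : ∀ n, (0 : ℝ) ≤ rowSparsity V i n := fun n => Nat.cast_nonneg _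
  have hq1 : 0 < 2 * cUp / cLo := by positivity
  have hq2 : 0 < 6 * cUp / m := by positivity
  have hsR1 : ∀ n, (2 + 2 * cUp / cLo) * (rowSparsity V i n : ℝ) + 1 < (sR n : ℝ) := fun n => by
    rw [hsRc]
    have := mul_le_mul_of_nonneg_right
      (show 2 + 2 * cUp / cLo ≤ (N : ℝ) by linarith) (hs0 n)
    linarith
  have hsR2 : ∀ n, 6 * cUp / m * (rowSparsity V i n : ℝ) < (sR n : ℝ) := fun n => by
    rw [hsRc]
    have := mul_le_mul_of_nonneg_right (show 6 * cUp / m ≤ (N : ℝ) by linarith) (hs0 n)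
    linarith
  have hsRO : (fun n => (sR n : ℝ)) =O[atTop] (fun n => max 1 (rowSparsity V i n : ℝ)) := by
    refine Asymptotics.IsBigO.of_bound (N + 2) (Eventually.of_forall fun n => ?_)
    rw [Real.norm_of_nonneg (Nat.cast_nonneg _), Real.norm_of_nonneg (by positivity), hsRc,
      add_mul]
    gcongr
    · exact le_max_right _ _
    · linarith [le_max_left 1 (rowSparsity V i n : ℝ)]
  have hlim := ((h.holdsWHP_gramEvent hm).add hD).add (hR sR hsR1 hsRO)
  rw [add_zero, add_zero] at hlim
  have hε' : (0 : ENNReal) < ENNReal.ofReal ε := ENNReal.ofReal_pos.2 hε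
  filter_upwards [hlim.eventually_le_const hε', h.eventually_log, h.eventually_level hm,
    h.eventually_rate_le 9 (half_pos hm)] with n hμ hn hlev hrate
  refine le_trans ?_ hμ
  refine measure_le_add_measure_compl ?_
  filter_upwards [haHat n, (V n).ae_recursion] with ω hω hrec hG hNo hRi
  refine not_lt.2 ?_
  rw [abs_of_nonneg (Nat.cast_nonneg _), abs_of_nonneg (hs0 n)]
  have hn0 : (0 : ℝ) < n := hlev.2.2.2
  set r := √(Real.log (V n).p / (n : ℝ)) with hr
  have hr0 : 0 < r := Real.sqrt_pos.2 (div_pos (by linarith [hn.2]) hn0)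
  have hlam4 : 4 * (C₁ * r) ≤ lam n := by
    refine le_trans ?_ (hlam n)
    have h1 : 1 ≤ cUp / cLo := (one_le_div hcLo).2 hcUp.le
    calc 4 * (C₁ * r) ≤ 4 * (C₁ * r) * (cUp / cLo) := le_mul_of_one_le_right (by positivity) h1
      _ = _ := by ring
  have hlam0 : 0 < lam n := lt_of_lt_of_le (by positivity) hlam4
  have hY : (V n).response (i n) n ω =
      (V n).design n ω *ᵥ (V n).A (i n) + (V n).noise (i n) n ω := by
    funext t
    have := hrec t (i n)
    simp only [GaussianVAR.response, GaussianVAR.noise, Pi.add_apply, this]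
    congr 1
    exact dotProduct_comm _ _
  refine hω.numNonzero_le hn.1 hlam0 hY (fun j => ?_) hm hlev.1 hcUp0 (fun v => ?_) ?_
    (fun v hv => (hRi v hv).2) (hsR2 n)
  · have := hNo j
    linarith
  · have h1 := abs_le.1 (h.abs_gram_sub_le hm hG v)
    have h2 := (h.bounds n).le_statForm hm (h.pos hm).le v
    linarith
  · refine le_trans ?_ hrate
    gcongr
    · exact hlev.1
    · exact le_max_right _ _

end Asymptotics

theorem mainTheorem3 (m M : ℝ) (hm : 0 < m) :
    (∃ C₁ cLo cUp : ℝ, 0 < C₁ ∧ 0 < cLo ∧ cLo < cUp ∧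
      ∀ (V : ℕ → GaussianVAR.{u}) (i : ∀ n, Fin (V n).p), SparseRegime V i m M →
        IsDeviationConstant V i C₁ ∧ IsSparseRiesz V i cLo cUp) ∧
    (∀ (V : ℕ → GaussianVAR.{u}) (i : ∀ n, Fin (V n).p), SparseRegime V i m M →
      ∀ C₁ cLo cUp : ℝ, 0 < C₁ → 0 < cLo → cLo < cUp →
        IsDeviationConstant V i C₁ → IsSparseRiesz V i cLo cUp →
        ∀ lam : ℕ → ℝ,
          (∀ n, 4 * C₁ * cUp / cLo * √(Real.log (V n).p / (n : ℝ)) ≤ lam n) →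
        ∀ aHat : ∀ n, (V n).Ω → Fin (V n).p → ℝ,
          (∀ n, ∀ᵐ ω ∂(V n).μ,
            IsLasso ((V n).design n ω) ((V n).response (i n) n ω) (lam n) (aHat n ω)) →
        IsBigOInProb V (fun n ω => (numNonzero (aHat n ω) : ℝ))
          (fun n => (rowSparsity V i n : ℝ))) := by
  refine ⟨?_, fun V i h C₁ cLo cUp hC₁ hcLo hcUp hD hR lam hlam aHat haHat =>
    h.isBigOInProb_numNonzero hm hC₁ hcLo hcUp hD hR hlam haHat⟩
  by_cases hM : 0 < M
  · refine ⟨4 * GaussianVAR.proxy m M, m / 2, M / m + m, by linarith [proxy_pos hm hM], by linarith,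
      ?_, fun V i h => ⟨h.isDeviationConstant hm, h.isSparseRiesz hm⟩⟩
    have : 0 < M / m := by positivity
    linarith
  · -- the regime forces `m ≤ M`, so that no sequence of models satisfies it
    exact ⟨1, 1, 2, one_pos, one_pos, one_lt_two, fun V i h => absurd (h.pos hm) hM⟩
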